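/- All digraphs are finite, without loops and without multiple arcs. For a digraph $D$ and a vertex $v$, let $d(v)=d^+(v)+d^-(v)$ be the sum of its out-degree and its in-degree. A set $\{x,y\}$ of two distinct vertices is a dominating pair if there is a vertex $z$ with $x\to z$ and $y\to z$. A digraph is strong if for all vertices $x,y$ there is a directed path from $x$ to $y$; it is balanced bipartite if its vertex set is the disjoint union of two independent sets of the same size; it is hamiltonian if it has a directed cycle through all its vertices. Write $u\leftrightarrow v$ if both arcs $u\to v$ and $v\to u$ are present. Define the following digraphs, whose arcs are exactly those listed. - $H_1$, on the vertices $x_1,x_2,y_1,y_2$: $x_1\leftrightarrow y_1$, $x_2\leftrightarrow y_1$, $x_2\leftrightarrow y_2$. - $H_2$, on the vertices $x_1,x_2,x_3,y_1,y_2,y_3$: $x_1\leftrightarrow y_1$, $x_2\leftrightarrow y_1$, $x_3\leftrightarrow y_2$, $x_3\leftrightarrow y_3$, $y_2\to x_1$, $y_2\to x_2$, $y_3\to x_1$, $y_3\to x_2$, $y_1\to x_3$; the arc $x_3\to y_1$ may be present or not, so that $H_2$ stands for two digraphs. - $H_3$, on the vertices $x_1,x_2,x_3,y_1,y_2,y_3$: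 $x_1\to y_2$, $y_2\to x_2$, $x_2\to y_1$, $y_1\to x_1$, $x_1\leftrightarrow y_3$, $x_2\leftrightarrow y_3$, $x_3\leftrightarrow y_1$, $x_3\leftrightarrow y_2$. **Theorem.** Let $D$ be a strong balanced bipartite digraph on $2a$ vertices, where $a\ge 2$. Suppose that for every dominating pair $\{x,y\}$ of $D$, either $d(x)\ge 2a-2$ and $d(y)\ge a+1$, or $d(y)\ge 2a-2$ and $d(x)\ge a+1$. Then $D$ is hamiltonian or isomorphic to $H_1$, to $H_2$ (with or without the arc $x_3\to y_1$), or to $H_3$. None of the digraphs $H_1$, $H_2$ (in either form), $H_3$ is hamiltonian. -/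

import Mathlib

namespace Digraph

/-- The out-degree `d⁺(v)`: the number of vertices dominated by `v`. -/
noncomputable def outDeg {V : Type*} (D : Digraph V) (v : V) : ℕ :=
  {w : V | D.Adj v w}.ncard

/-- The in-degree `d⁻(v)`: the number of vertices that dominate `v`. -/
noncomputable def inDeg {V : Type*} (D : Digraph V) (v : V) : ℕ :=
  {w : V | D.Adj w v}.ncard

/-- The degree `d(v) = d⁺(v) + d⁻(v)`. -/
noncomputable def deg {V : Type*} (D : Digraph V) (v : V) : ℕ :=
  D.outDeg v + D.inDeg v

/-- `D` is strong: every vertex can be reached from every vertex along arcs of `D`. -/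
def IsStrong {V : Type*} (D : Digraph V) : Prop :=
  ∀ x y : V, Relation.ReflTransGen D.Adj x y

/-- `D` is balanced bipartite: its vertex set is the disjoint union of two sets `V₁` and `V₂`
of the same size such that no arc of `D` has both ends in `V₁` or both ends in `V₂`
(in particular `D` has no loops). -/
def IsBalancedBipartite {V : Type*} (D : Digraph V) : Prop :=
  ∃ V₁ V₂ : Set V, Disjoint V₁ V₂ ∧ V₁ ∪ V₂ = Set.univ ∧ V₁.ncard = V₂.ncard ∧
    (∀ u ∈ V₁, ∀ v ∈ V₁, ¬ D.Adj u v) ∧ (∀ u ∈ V₂, ∀ v ∈ V₂, ¬ D.Adj u v)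

/-- `{x, y}` is a dominating pair: `x` and `y` are distinct and both dominate some vertex `z`. -/
def IsDominatingPair {V : Type*} (D : Digraph V) (x y : V) : Prop :=
  x ≠ y ∧ ∃ z : V, D.Adj x z ∧ D.Adj y z

/-- `c` lists the vertices of a directed cycle of length `n ≥ 2` of `D` in cyclic order:
they are distinct and each dominates the next one (indices modulo `n`). -/
def IsDirectedCycle {V : Type*} (D : Digraph V) (n : ℕ) (c : ZMod n → V) : Prop :=
  2 ≤ n ∧ Function.Injective c ∧ ∀ i : ZMod n, D.Adj (c i) (c (i + 1))

/-- `D` is hamiltonian: it has a directed cycle that includes every vertex. -/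
def IsHamiltonian {V : Type*} (D : Digraph V) : Prop :=
  ∃ (n : ℕ) (c : ZMod n → V), D.IsDirectedCycle n c ∧ Function.Surjective c

/-- Two digraphs are isomorphic: there is a bijection of the vertices that preserves and
reflects arcs. -/
def IsIsomorphic {V W : Type*} (D : Digraph V) (H : Digraph W) : Prop :=
  Nonempty (D.Adj ≃r H.Adj)

end Digraph

/-- The vertex `x₁, …, x_m` of a digraph on `x₁, …, x_m, y₁, …, y_m`, with indices from `0`:
`vx 0` is `x₁`, `vx 1` is `x₂`, and so on. -/
abbrev vx {m : ℕ} (i : Fin m) : Fin m ⊕ Fin m := Sum.inl i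

/-- Likewise `vy 0` is `y₁`, `vy 1` is `y₂`, and so on. -/
abbrev vy {m : ℕ} (i : Fin m) : Fin m ⊕ Fin m := Sum.inr i

/-- The digraph on `4` vertices with the 2-cycles `x₁y₁`, `y₁x₂`, `x₂y₂` and no other arcs. -/
def digraphH1 : Digraph (Fin 2 ⊕ Fin 2) where
  Adj u v := (u, v) ∈ ([
    (vx 0, vy 0), (vy 0, vx 0),
    (vx 1, vy 0), (vy 0, vx 1),
    (vx 1, vy 1), (vy 1, vx 1)] : List ((Fin 2 ⊕ Fin 2) × (Fin 2 ⊕ Fin 2)))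

/-- The digraph on `6` vertices with the 2-cycles `x₁y₁`, `x₂y₁`, `x₃y₂`, `x₃y₃`, the arcs from
`y₂` and `y₃` to `x₁` and `x₂`, the arc `y₁ → x₃`, the optional arc `x₃ → y₁` (present exactly
when `b` holds), and no other arcs. -/
def digraphH2 (b : Prop) : Digraph (Fin 3 ⊕ Fin 3) where
  Adj u v := (u, v) ∈ ([
    (vx 0, vy 0), (vy 0, vx 0),
    (vx 1, vy 0), (vy 0, vx 1),
    (vx 2, vy 1), (vy 1, vx 2),
    (vx 2, vy 2), (vy 2, vx 2),
    (vy 1, vx 0), (vy 1, vx 1),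
    (vy 2, vx 0), (vy 2, vx 1),
    (vy 0, vx 2)] : List ((Fin 3 ⊕ Fin 3) × (Fin 3 ⊕ Fin 3))) ∨
    (b ∧ u = vx 2 ∧ v = vy 0)

/-- The digraph on `6` vertices with the directed 4-cycle `x₁ → y₂ → x₂ → y₁ → x₁`, the 2-cycles
`x₁y₃`, `x₂y₃`, `x₃y₁`, `x₃y₂`, and no other arcs. -/
def digraphH3 : Digraph (Fin 3 ⊕ Fin 3) where
  Adj u v := (u, v) ∈ ([
    (vx 0, vy 1), (vy 1, vx 1), (vx 1, vy 0), (vy 0, vx 0),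
    (vx 0, vy 2), (vy 2, vx 0),
    (vx 1, vy 2), (vy 2, vx 1),
    (vx 2, vy 0), (vy 0, vx 2),
    (vx 2, vy 1), (vy 1, vx 2)] : List ((Fin 3 ⊕ Fin 3) × (Fin 3 ⊕ Fin 3)))

/-! Measure a vertex `v` by `miss`, the number `2a - d(v)` of arcs it lacks compared with the
complete bipartite digraph. The hypothesis becomes: in each dominating pair one vertex lacks at most
2 arcs and the other at most `a - 1`.

Hall's theorem applied to out-neighbourhoods gives a cycle factor, stored as its successor
permutation `s`, unless a deficient set exists; the degree condition then leaves no freedom and the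
digraph is `H₂` (`isIsomorphic_digraphH2_of_card_lt`). If `p` and `q` lie on different cycles and
both `p → s q` and `q → s p` are arcs, exchanging successors merges the two cycles. So take a factor
admitting no such merger. For every union `C` of its cycles, each pair `v ∈ C`, `u ∉ C` of one
colour then lacks `v → s u` or `u → s v`, and `IsSplit.missOut_add_missIn` turns this into many
missing arcs.

A 2-cycle meets this bound with equality, which fixes its arcs to the rest and forces every other
vertex to lack at most 2 arcs (`IsSplit.isTightTwoCycle`). For `a = 3` a factor with several cycles
contains a 2-cycle, and the case analysis ends in a hamiltonian cycle or `H₃`; `a = 2` is done by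
hand and produces `H₁`. For `a ≥ 4` a 2-cycle can be inserted into the rest by rerouting
(`isHamiltonian_of_two_cycle`).

What remains is `a ≥ 4`, several cycles, none of length 2. Then every vertex lacks at most `a - 1`
arcs (`IsUnmergeable.miss_le`). Counting missing arcs on both sides of a split, with the fact that
two vertices lacking more than 2 arcs never form a dominating pair, leaves only very small sides
(`count_cases`): either both are complete, or both have four vertices and one is complete. In each
case strong connectivity allows the sides to be joined into a hamiltonian cycle. -/

set_option linter.unusedSectionVars false

namespace Digraph

open Finset Equiv Equiv.Perm

/-! ### Merging two cycles of a permutation by a transposition. -/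

section Perm
variable {V : Type*} [Fintype V] [DecidableEq V]

/-- Following `s * swap p q` from `s p` stays on the `s`-cycle of `p` until it reaches `p`. -/
theorem sameCycle_mul_swap_apply_self {s : Perm V} {p q : V} (h : ¬ s.SameCycle p q) :
    (s * swap p q).SameCycle (s p) p := by
  have hex : ∃ k : ℕ, (s ^ k) (s p) = p := by
    have h1 : s.SameCycle (s p) p := (sameCycle_apply_left).2 (SameCycle.refl s p)
    obtain ⟨k, -, hk⟩ := h1.exists_pow_eq'
    exact ⟨k, hk⟩
  classical
  have key : ∀ j ≤ Nat.find hex, ((s * swap p q) ^ j) (s p) = (s ^ j) (s p) := by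
    intro j
    induction j with
    | zero => intro _; simp
    | succ j ih =>
      intro hj
      rw [pow_succ', pow_succ', Perm.mul_apply, Perm.mul_apply, ih (by omega), Perm.mul_apply,
        swap_apply_of_ne_of_ne]
      · exact Nat.find_min hex (by omega)
      · intro hq
        apply h
        rw [← hq]
        exact (sameCycle_pow_right).2 ((sameCycle_apply_right).2 (SameCycle.refl s p))
  refine ⟨(Nat.find hex : ℤ), ?_⟩
  rw [zpow_natCast, key _ le_rfl]
  exact Nat.find_spec hex

/-- The new permutation sends `p` to `s q`, and from there the old cycle of `q` is followed as far
as `q`. -/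
theorem sameCycle_mul_swap {s : Perm V} {p q : V} (h : ¬ s.SameCycle p q) :
    (s * swap p q).SameCycle p q := by
  have h1 := sameCycle_mul_swap_apply_self (fun h' => h (SameCycle.symm h') : ¬ s.SameCycle q p)
  rw [swap_comm] at h1
  have h2 : (s * swap p q) p = s q := by simp
  rw [← h2] at h1
  exact (sameCycle_apply_left).1 h1

theorem SameCycle.mul_swap {s : Perm V} {p q : V} (h : ¬ s.SameCycle p q) {x y : V}
    (hxy : s.SameCycle x y) : (s * swap p q).SameCycle x y := by
  have step : ∀ x, (s * swap p q).SameCycle x (s x) := by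
    intro x
    by_cases hp : x = p
    · subst hp
      exact (sameCycle_mul_swap_apply_self h).symm
    by_cases hq : x = q
    · subst hq
      have := sameCycle_mul_swap_apply_self (fun h' => h (SameCycle.symm h') : ¬ s.SameCycle x p)
      rw [swap_comm] at this
      exact this.symm
    · have h2 : (s * swap p q) x = s x := by
        rw [Perm.mul_apply, swap_apply_of_ne_of_ne hp hq]
      rw [← h2]
      exact (sameCycle_apply_right).2 (SameCycle.refl _ x)
  obtain ⟨k, -, hk⟩ := hxy.exists_pow_eq'
  rw [← hk]
  clear hk
  induction k with
  | zero => simpa using SameCycle.refl _ x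
  | succ k ih =>
    rw [pow_succ', Perm.mul_apply]
    exact ih.trans (step _)

end Perm

/-! ### Cycle factors, unmergeable factors and hamiltonian cycles. -/

section Factor
variable {V : Type*} [Fintype V] (D : Digraph V)

/-- A cycle factor of `D`, given by its successor permutation. -/
def IsFactor (s : Perm V) : Prop := ∀ v, D.Adj v (s v)

/-- A cycle factor no two cycles of which can be merged by exchanging the ends of two arcs. -/
def IsUnmergeable (s : Perm V) : Prop :=
  ∀ p q, ¬ s.SameCycle p q → D.Adj p (s q) → ¬ D.Adj q (s p)

variable {D}

theorem IsFactor.mul_swap [DecidableEq V] {s : Perm V} (hs : D.IsFactor s) {p q : V}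
    (h₁ : D.Adj p (s q)) (h₂ : D.Adj q (s p)) : D.IsFactor (s * swap p q) := by
  intro v
  by_cases hp : v = p
  · subst hp; simpa using h₁
  by_cases hq : v = q
  · subst hq; simpa using h₂
  rw [Perm.mul_apply, swap_apply_of_ne_of_ne hp hq]
  exact hs v

/-- Maximise the number of pairs of vertices lying on a common cycle: a merger keeps all such pairs
and adds `(p, q)`. -/
theorem IsFactor.exists_isUnmergeable {s : Perm V} (hs : D.IsFactor s) :
    ∃ t, D.IsFactor t ∧ D.IsUnmergeable t := by
  classical
  obtain ⟨t, ht, hmax⟩ := (univ.filter D.IsFactor).exists_max_image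
    (fun t : Perm V => (univ.filter fun x : V × V => t.SameCycle x.1 x.2).card) ⟨s, by simpa using hs⟩
  simp only [mem_filter, mem_univ, true_and] at ht hmax
  refine ⟨t, ht, fun p q hpq h₁ h₂ => ?_⟩
  have h := hmax _ (ht.mul_swap h₁ h₂)
  refine absurd h (not_le.2 (card_lt_card ?_))
  rw [Finset.ssubset_iff_of_subset]
  · exact ⟨(p, q), by simpa using sameCycle_mul_swap hpq, by simpa using hpq⟩
  · intro x
    simp only [mem_filter, mem_univ, true_and]
    exact SameCycle.mul_swap hpq

theorem IsFactor.isHamiltonian {s : Perm V} (hs : D.IsFactor s) (h1 : ∀ x y, s.SameCycle x y)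
    (h2 : 2 ≤ Fintype.card V) : D.IsHamiltonian := by
  classical
  have : Nonempty V := Fintype.card_pos_iff.1 (by omega)
  obtain ⟨v⟩ := this
  have : NeZero (Fintype.card V) := ⟨by omega⟩
  have hcyc : s.IsCycle := ⟨v, fun h => by
    obtain ⟨w, hw⟩ := Fintype.exists_ne_of_one_lt_card (by omega) v
    obtain ⟨k, hk⟩ := h1 v w
    exact hw (by rw [← hk]; exact ((Function.IsFixedPt.perm_zpow h k : Function.IsFixedPt _ _))), fun y _ => h1 v y⟩
  have hsupp : s.support = univ := by
    ext x
    simp only [mem_support, mem_univ, iff_true]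
    intro h
    obtain ⟨w, hw⟩ := Fintype.exists_ne_of_one_lt_card (by omega) x
    obtain ⟨k, hk⟩ := h1 x w
    exact hw (by rw [← hk]; exact ((Function.IsFixedPt.perm_zpow h k : Function.IsFixedPt _ _)))
  have hord : s ^ Fintype.card V = 1 := by
    have := hcyc.orderOf
    rw [hsupp, card_univ] at this
    rw [← this, pow_orderOf_eq_one]
  have hsurj : Function.Surjective (fun i : ZMod (Fintype.card V) => (s ^ i.val) v) := by
    intro w
    obtain ⟨k, -, hk⟩ := (h1 v w).exists_pow_eq'
    refine ⟨(k : ZMod (Fintype.card V)), ?_⟩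
    simp only [ZMod.val_natCast]
    rw [← hk]
    conv_rhs => rw [← Nat.mod_add_div k (Fintype.card V), pow_add, pow_mul, hord, one_pow, mul_one]
  refine ⟨Fintype.card V, fun i => (s ^ i.val) v, ⟨h2, ?_, ?_⟩, hsurj⟩
  · exact ((Fintype.bijective_iff_surjective_and_card _).2 ⟨hsurj, by simp [ZMod.card]⟩).1
  · intro i
    have : (s ^ (i + 1).val) v = s ((s ^ i.val) v) := by
      rw [← Perm.mul_apply, ← pow_succ']
      have h3 : (i + 1).val = (i.val + 1) % Fintype.card V := by
        rw [ZMod.val_add, ZMod.val_one_eq_one_mod, Nat.add_mod_mod]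
      rw [h3]
      conv_rhs => rw [← Nat.mod_add_div (i.val + 1) (Fintype.card V), pow_add, pow_mul, hord,
        one_pow, mul_one]
    simp only [this]
    exact hs _

/-- A closed walk through all vertices whose length is the number of vertices is a
hamiltonian cycle. -/
theorem isHamiltonian_of_closedWalk {n : ℕ} (c : ZMod n → V) (hn : 2 ≤ n)
    (hV : Fintype.card V = n) (hadj : ∀ i, D.Adj (c i) (c (i + 1)))
    (hc : Function.Surjective c) : D.IsHamiltonian := by
  have : NeZero n := ⟨by omega⟩
  exact ⟨n, c, ⟨hn, ((Fintype.bijective_iff_surjective_and_card _).2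
    ⟨hc, by rw [ZMod.card, hV]⟩).1, hadj⟩, hc⟩

/-- In a strong digraph every nonempty proper set of vertices is left by an arc. -/
theorem IsStrong.exists_adj_of_mem {V : Type*} {D : Digraph V} (h : D.IsStrong) (S : Set V)
    {x y : V} (hx : x ∈ S) (hy : y ∉ S) : ∃ u ∈ S, ∃ v ∉ S, D.Adj u v := by
  by_contra! hcon
  have : ∀ z, Relation.ReflTransGen D.Adj x z → z ∈ S := by
    intro z hz
    induction hz with
    | refl => exact hx
    | tail _ hbc ih =>
      by_contra hc
      exact hcon _ ih _ hc hbc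
  exact hy (this y (h x y))

end Factor

/-! ### Two-colourings and counting missing arcs. -/

section Colour
variable {V : Type*} [Fintype V]

/-- `b` is a proper colouring of `D` by two colours, each used for `a` vertices. -/
structure IsBicoloring (D : Digraph V) (b : V → Bool) (a : ℕ) : Prop where
  ne_of_adj : ∀ {u v}, D.Adj u v → b u ≠ b v
  card_eq : ∀ i, (univ.filter fun v => b v = i).card = a

open Classical in
/-- The number of vertices in `S` of the other colour that `v` does not dominate. -/
noncomputable def missOut (D : Digraph V) (b : V → Bool) (S : Finset V) (v : V) : ℕ :=
  (S.filter fun w => b w ≠ b v ∧ ¬ D.Adj v w).card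

open Classical in
/-- The number of vertices in `S` of the other colour that do not dominate `v`. -/
noncomputable def missIn (D : Digraph V) (b : V → Bool) (S : Finset V) (v : V) : ℕ :=
  (S.filter fun w => b w ≠ b v ∧ ¬ D.Adj w v).card

/-- The number of arcs that `v` lacks to a complete bipartite digraph. -/
noncomputable def miss (D : Digraph V) (b : V → Bool) (v : V) : ℕ :=
  D.missOut b univ v + D.missIn b univ v

variable {D : Digraph V} {b : V → Bool} {a : ℕ}

theorem IsBicoloring.color_right (h : D.IsBicoloring b a) {u v : V} (huv : D.Adj u v) :
    b v = !b u := by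
  have := h.ne_of_adj huv
  cases h1 : b u <;> cases h2 : b v <;> simp_all

theorem IsBicoloring.color_left (h : D.IsBicoloring b a) {u v : V} (huv : D.Adj u v) :
    b u = !b v := by
  rw [h.color_right huv, Bool.not_not]

theorem IsBicoloring.card_ne (h : D.IsBicoloring b a) (v : V) :
    (univ.filter fun w => b w ≠ b v).card = a := by
  rw [← h.card_eq (!b v)]
  congr 1
  ext w
  simp only [mem_filter, mem_univ, true_and]
  cases b w <;> cases b v <;> simp

theorem IsBicoloring.outDeg_add_missOut (h : D.IsBicoloring b a) (v : V) :
    D.outDeg v + D.missOut b univ v = a := by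
  classical
  rw [← h.card_ne v, outDeg, missOut,
    ← card_filter_add_card_filter_not (s := univ.filter fun w => b w ≠ b v) (fun w => D.Adj v w),
    filter_filter, filter_filter, Set.ncard_eq_toFinset_card']
  congr 2
  ext w
  simp only [Set.mem_toFinset, Set.mem_ofPred_eq, mem_filter, mem_univ, true_and]
  exact ⟨fun hw => ⟨(h.ne_of_adj hw).symm, hw⟩, fun hw => hw.2⟩

theorem IsBicoloring.inDeg_add_missIn (h : D.IsBicoloring b a) (v : V) :
    D.inDeg v + D.missIn b univ v = a := by
  classical
  rw [← h.card_ne v, inDeg, missIn,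
    ← card_filter_add_card_filter_not (s := univ.filter fun w => b w ≠ b v) (fun w => D.Adj w v),
    filter_filter, filter_filter, Set.ncard_eq_toFinset_card']
  congr 2
  ext w
  simp only [Set.mem_toFinset, Set.mem_ofPred_eq, mem_filter, mem_univ, true_and]
  exact ⟨fun hw => ⟨(h.ne_of_adj hw), hw⟩, fun hw => hw.2⟩

theorem IsBicoloring.deg_add_miss (h : D.IsBicoloring b a) (v : V) :
    D.deg v + D.miss b v = 2 * a := by
  have h1 := h.outDeg_add_missOut v
  have h2 := h.inDeg_add_missIn v
  unfold deg miss
  omega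

theorem missOut_add_compl [DecidableEq V] (C : Finset V) (v : V) :
    D.missOut b C v + D.missOut b Cᶜ v = D.missOut b univ v := by
  classical
  unfold missOut
  rw [← card_union_of_disjoint, ← filter_union, union_compl]
  exact (disjoint_compl_right).mono (filter_subset _ _) (filter_subset _ _)

theorem missIn_add_compl [DecidableEq V] (C : Finset V) (v : V) :
    D.missIn b C v + D.missIn b Cᶜ v = D.missIn b univ v := by
  classical
  unfold missIn
  rw [← card_union_of_disjoint, ← filter_union, union_compl]
  exact (disjoint_compl_right).mono (filter_subset _ _) (filter_subset _ _)

theorem card_le_missOut {S A : Finset V} {v : V} (hA : A ⊆ S)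
    (h : ∀ w ∈ A, b w ≠ b v ∧ ¬ D.Adj v w) : A.card ≤ D.missOut b S v :=
  card_le_card fun w hw => by simpa using ⟨hA hw, (h w hw).1, (h w hw).2⟩

theorem card_le_missIn {S A : Finset V} {v : V} (hA : A ⊆ S)
    (h : ∀ w ∈ A, b w ≠ b v ∧ ¬ D.Adj w v) : A.card ≤ D.missIn b S v :=
  card_le_card fun w hw => by simpa using ⟨hA hw, (h w hw).1, (h w hw).2⟩

theorem card_add_card_le_miss {A B : Finset V} {v : V}
    (hA : ∀ w ∈ A, b w ≠ b v ∧ ¬ D.Adj v w) (hB : ∀ w ∈ B, b w ≠ b v ∧ ¬ D.Adj w v) :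
    A.card + B.card ≤ D.miss b v :=
  add_le_add (card_le_missOut (subset_univ _) hA) (card_le_missIn (subset_univ _) hB)

/-- The degree condition on dominating pairs, in terms of missing arcs. -/
def PairCondition (D : Digraph V) (b : V → Bool) (a : ℕ) : Prop :=
  ∀ x y, D.IsDominatingPair x y → (D.miss b x ≤ 2 ∧ D.miss b y ≤ a - 1) ∨
    (D.miss b y ≤ 2 ∧ D.miss b x ≤ a - 1)

theorem PairCondition.le (h : D.PairCondition b a) (ha : 3 ≤ a) {x y : V}
    (hxy : D.IsDominatingPair x y) : D.miss b x ≤ a - 1 := by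
  rcases h x y hxy with h | h <;> omega

theorem PairCondition.or (h : D.PairCondition b a) {x y : V}
    (hxy : D.IsDominatingPair x y) : D.miss b x ≤ 2 ∨ D.miss b y ≤ 2 := by
  rcases h x y hxy with h | h <;> omega

end Colour

/-! ### Arcs missing between the two sides of an unmergeable split. -/

section Split
variable {V : Type*} [Fintype V] [DecidableEq V] {D : Digraph V} {b : V → Bool} {a : ℕ}

/-- `C` is a union of cycles of the factor `s`, none of which can be merged with a cycle
outside `C` by exchanging the ends of two arcs. -/
structure IsSplit (D : Digraph V) (s : Perm V) (C : Finset V) : Prop where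
  apply_mem_iff : ∀ v, s v ∈ C ↔ v ∈ C
  not_adj : ∀ p ∈ C, ∀ q ∉ C, D.Adj p (s q) → ¬ D.Adj q (s p)

theorem IsSplit.compl {s : Perm V} {C : Finset V} (h : D.IsSplit s C) : D.IsSplit s Cᶜ where
  apply_mem_iff v := by simp [h.apply_mem_iff]
  not_adj p hp q hq h₁ h₂ := h.not_adj q (by simpa using hq) p (by simpa using hp) h₂ h₁

open Classical in
theorem IsUnmergeable.isSplit {s : Perm V} (h : D.IsUnmergeable s) (x : V) :
    D.IsSplit s (univ.filter (s.SameCycle x)) where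
  apply_mem_iff v := by simp [sameCycle_apply_right]
  not_adj p hp q hq := by
    simp only [mem_filter, mem_univ, true_and] at hp hq
    exact h p q fun hpq => hq (hp.trans hpq)

theorem IsSplit.card_filter {s : Perm V} {C : Finset V} (h : D.IsSplit s C) (hs : D.IsFactor s)
    (hb : D.IsBicoloring b a) (i j : Bool) :
    (C.filter (b · = i)).card = (C.filter (b · = j)).card := by
  have key : ∀ i, (C.filter (b · = i)).card ≤ (C.filter (b · = !i)).card := by
    intro i
    refine card_le_card_of_injOn s ?_ s.injective.injOn
    intro v hv
    simp only [coe_filter, Set.mem_ofPred_eq] at hv ⊢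
    refine ⟨(h.apply_mem_iff v).2 hv.1, ?_⟩
    have := hb.ne_of_adj (hs v)
    rw [hv.2] at this
    cases i <;> simp_all
  have h1 := key i
  have h2 := key (!i)
  rw [Bool.not_not] at h2
  rcases Bool.eq_or_eq_not j i with rfl | rfl
  · rfl
  · omega

/-- Index the possible arcs `v → s u` and `u → s v` by the vertices `u ∉ C` coloured like `v`.
Unmergeability says that at least one of the two is missing for each `u`, so inclusion-exclusion
counts each `u` once, and once more when both are missing. -/
theorem IsSplit.missOut_add_missIn {s : Perm V} {C : Finset V} (h : D.IsSplit s C)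
    (hs : D.IsFactor s) (hb : D.IsBicoloring b a) {v : V} (hv : v ∈ C) :
    D.missOut b Cᶜ v + D.missIn b Cᶜ (s v) =
      (Cᶜ.filter (b · = b v)).card +
        (open Classical in
          Cᶜ.filter fun u => b u = b v ∧ ¬ D.Adj v (s u) ∧ ¬ D.Adj u (s v)).card := by
  classical
  have hne : ∀ u w, b (s u) ≠ b w ↔ b u = b w := by
    intro u w
    have := hb.ne_of_adj (hs u)
    cases h1 : b (s u) <;> cases h2 : b u <;> cases h3 : b w <;> simp_all
  have e1 : D.missOut b Cᶜ v = (Cᶜ.filter fun u => b u = b v ∧ ¬ D.Adj v (s u)).card := by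
    unfold missOut
    symm
    refine card_bij (fun u _ => s u) ?_ (fun u _ w _ h => s.injective h) ?_
    · intro u hu
      simp only [mem_filter, mem_compl, h.apply_mem_iff, hne] at hu ⊢
      exact hu
    · intro w hw
      refine ⟨s.symm w, ?_, by simp⟩
      simp only [mem_filter, mem_compl] at hw ⊢
      rw [← h.apply_mem_iff, ← hne (s.symm w) v]
      simpa using hw
  have e2 : D.missIn b Cᶜ (s v) = (Cᶜ.filter fun u => b u = b v ∧ ¬ D.Adj u (s v)).card := by
    unfold missIn
    congr 1
    ext u
    simp only [mem_filter]
    rw [ne_comm, hne, eq_comm]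
  rw [e1, e2, ← card_union_add_card_inter]
  congr 2
  · ext u
    simp only [mem_union, mem_filter, mem_compl]
    have := h.not_adj v hv u
    tauto
  · ext u
    simp only [mem_inter, mem_filter, mem_compl]
    tauto

end Split

/-! ### The structure around a 2-cycle of an unmergeable factor. -/

section TwoCycle
variable {V : Type*} [Fintype V] [DecidableEq V] {D : Digraph V} {b : V → Bool} {a : ℕ}

theorem IsSplit.swap_two_cycle {s : Perm V} {x : V}
    (h : D.IsSplit s {x, s x}) (hxx : s (s x) = x) : D.IsSplit s {s x, s (s x)} := by
  rw [hxx, Finset.pair_comm]; exact h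

theorem PairCondition.miss_le_of_adj (hP : D.PairCondition b a) (ha : 3 ≤ a) {s : Perm V}
    (hs : D.IsFactor s) {p q : V} (h : D.Adj p q) (hq : q ≠ s p) : D.miss b p ≤ a - 1 := by
  refine hP.le ha (y := s.symm q) ⟨?_, q, h, ?_⟩
  · rintro rfl; simp at hq
  · simpa using hs (s.symm q)

theorem PairCondition.miss_symm_le_of_adj (hP : D.PairCondition b a) (ha : 3 ≤ a) {s : Perm V}
    (hs : D.IsFactor s) {p q : V} (h : D.Adj p (s q)) (hq : p ≠ q) : D.miss b q ≤ a - 1 :=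
  hP.le ha (y := p) ⟨hq.symm, s q, hs q, h⟩

theorem card_compl_pair_filter (hb : D.IsBicoloring b a) {x y : V} (hxy : b y ≠ b x) :
    (({x, y} : Finset V)ᶜ.filter (b · = b x)).card = a - 1 := by
  have : ({x, y} : Finset V)ᶜ.filter (b · = b x) = (univ.filter (b · = b x)).erase x := by
    ext v
    simp only [mem_filter, mem_compl, mem_insert, mem_singleton, mem_erase, mem_univ, true_and]
    constructor
    · rintro ⟨h1, h2⟩
      exact ⟨fun h => h1 (Or.inl h), h2⟩
    · rintro ⟨h1, h2⟩
      refine ⟨?_, h2⟩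
      rintro (h | rfl)
      · exact h1 h
      · exact hxy h2
  rw [this, card_erase_of_mem (by simp), hb.card_eq]

/-- If `s x` lacked more than `a - 1` arcs, it would be in no dominating pair, so only `s x`
dominates `x`. This already costs `x` all `a - 1` other in-arcs. By strong connectivity some outside
`q` enters the 2-cycle, necessarily at `s x`, and then `x → s q` is missing as well: one arc too
many. -/
theorem IsSplit.miss_le_of_two_cycle (ha : 3 ≤ a) (hb : D.IsBicoloring b a)
    (hP : D.PairCondition b a) (hD : D.IsStrong) {s : Perm V} (hs : D.IsFactor s) {x : V}
    (h : D.IsSplit s {x, s x}) (hxx : s (s x) = x) (hx : D.miss b x ≤ a - 1) :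
    D.miss b (s x) ≤ a - 1 := by
  by_contra hcon
  have hbx : b (s x) ≠ b x := (hb.ne_of_adj (hs x)).symm
  have hcard := card_compl_pair_filter hb hbx
  have hcard' : (({x, s x} : Finset V)ᶜ.filter (b · = b (s x))).card = a - 1 := by
    rw [h.compl.card_filter hs hb _ (b x), hcard]
  have : (({x, s x} : Finset V)ᶜ.filter (b · = b x)).Nonempty := card_pos.1 (by omega)
  obtain ⟨z, hz⟩ := this
  simp only [mem_filter, mem_compl] at hz
  obtain ⟨q, hq, r, hr, hqr⟩ := hD.exists_adj_of_mem ((({x, s x} : Finset V)ᶜ : Finset V) : Set V)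
    (x := z) (y := x) (by simpa [and_comm] using hz.1) (by simp)
  have hq' : q ≠ x ∧ q ≠ s x := by simpa [and_comm] using hq
  have hr' : r = x ∨ r = s x := by simpa [or_iff_not_imp_right] using hr
  have hIn : ∀ q, q ≠ s x → ¬ D.Adj q x := fun q hq hqx =>
    hcon (hP.miss_symm_le_of_adj ha hs (p := q) (by rwa [hxx]) hq)
  have hqy : D.Adj q (s x) := by
    rcases hr' with rfl | rfl
    · exact absurd hqr (hIn q hq'.2)
    · exact hqr
  have h1 : a - 1 ≤ D.missIn b {x, s x}ᶜ x := by
    rw [← hcard']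
    refine card_le_missIn (filter_subset _ _) fun w hw => ?_
    simp only [mem_filter, mem_compl, mem_insert, mem_singleton, not_or] at hw
    exact ⟨hw.2 ▸ hbx, hIn w hw.1.2⟩
  have h2 : 1 ≤ D.missOut b {x, s x}ᶜ x := by
    rw [← card_singleton (s q)]
    refine card_le_missOut ?_ ?_
    · rw [singleton_subset_iff, mem_compl, h.apply_mem_iff]
      simpa using hq'
    · intro w hw
      rw [mem_singleton] at hw
      subst hw
      refine ⟨?_, fun hxq => h.not_adj x (by simp) q (by simpa using hq') hxq hqy⟩
      have e1 := hb.ne_of_adj (hs q)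
      have e2 := hb.ne_of_adj hqy
      cases h1 : b (s q) <;> cases h2 : b q <;> cases h3 : b (s x) <;> cases h4 : b x <;> simp_all
  have h3 := missIn_add_compl (D := D) (b := b) {x, s x} x
  have h4 := missOut_add_compl (D := D) (b := b) {x, s x} x
  unfold miss at hx
  omega

/-- The exact structure of a 2-cycle `x, s x` of a factor that cannot be merged with the rest. -/
structure IsTightTwoCycle (D : Digraph V) (b : V → Bool) (a : ℕ) (s : Perm V) (x : V) : Prop where
  miss_eq : D.miss b x = a - 1
  adj_iff : ∀ u, b u = b x → u ≠ x → (D.Adj x (s u) ↔ ¬ D.Adj u (s x))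
  adj_iff' : ∀ w, b w ≠ b x → w ≠ s x → (D.Adj (s x) (s w) ↔ ¬ D.Adj w x)
  miss_le : ∀ u, u ≠ x → u ≠ s x → D.miss b u ≤ 2
  missIn_eq : D.missIn b univ x = D.missIn b univ (s x)
  missIn_pos : 0 < D.missIn b univ x
  missIn_lt : D.missIn b univ x < a - 1

/-- The split identity at `x` and at `s x` gives at least `2(a - 1)` missing arcs between the
2-cycle and the rest, while each of its two vertices lacks at most `a - 1`. Equality throughout
yields the equivalences. Every other vertex is then in a dominating pair with `x` or with `s x`,
both of which lack exactly `a - 1` arcs. -/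
theorem IsSplit.isTightTwoCycle (ha : 3 ≤ a) (hb : D.IsBicoloring b a)
    (hP : D.PairCondition b a) (hD : D.IsStrong) {s : Perm V} (hs : D.IsFactor s) {x : V}
    (h : D.IsSplit s {x, s x}) (hxx : s (s x) = x) : D.IsTightTwoCycle b a s x := by
  classical
  have h' : D.IsSplit s {s x, s (s x)} := h.swap_two_cycle hxx
  have hbx : b (s x) ≠ b x := (hb.ne_of_adj (hs x)).symm
  have hcard := card_compl_pair_filter hb hbx
  have hcard' : (({x, s x} : Finset V)ᶜ.filter (b · = b (s x))).card = a - 1 := by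
    rw [h.compl.card_filter hs hb _ (b x), hcard]
  have : (({x, s x} : Finset V)ᶜ.filter (b · = b x)).Nonempty := card_pos.1 (by omega)
  obtain ⟨z, hz⟩ := this
  simp only [mem_filter, mem_compl] at hz
  obtain ⟨p, hp, q, hq, hpq⟩ := hD.exists_adj_of_mem (({x, s x} : Finset V) : Set V)
    (x := x) (y := z) (by simp) (by simpa using hz.1)
  have hp' : p = x ∨ p = s x := by simpa using hp
  have hq' : q ≠ x ∧ q ≠ s x := by simpa using hq
  have hboth : D.miss b x ≤ a - 1 ∧ D.miss b (s x) ≤ a - 1 := by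
    rcases hp' with rfl | rfl
    · have := hP.miss_le_of_adj ha hs hpq hq'.2
      exact ⟨this, h.miss_le_of_two_cycle ha hb hP hD hs hxx this⟩
    · have := hP.miss_le_of_adj ha hs hpq (by rw [hxx]; exact hq'.1)
      have h2 := h'.miss_le_of_two_cycle ha hb hP hD hs (by rw [hxx]) this
      rw [hxx] at h2
      exact ⟨h2, this⟩
  obtain ⟨hx, hy⟩ := hboth
  have c1 := h.missOut_add_missIn hs hb (v := x) (by simp)
  have c2 := h.missOut_add_missIn hs hb (v := s x) (by simp)
  rw [hxx] at c2
  have d1 := missIn_add_compl (D := D) (b := b) {x, s x} x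
  have d2 := missOut_add_compl (D := D) (b := b) {x, s x} x
  have d3 := missIn_add_compl (D := D) (b := b) {x, s x} (s x)
  have d4 := missOut_add_compl (D := D) (b := b) {x, s x} (s x)
  rw [hcard] at c1
  rw [hcard'] at c2
  have hx' := hx
  have hy' := hy
  unfold miss at hx' hy'
  set E1 := (({x, s x} : Finset V)ᶜ.filter fun u => b u = b x ∧ ¬ D.Adj x (s u) ∧ ¬ D.Adj u (s x))
    with hE1
  set E2 := (({x, s x} : Finset V)ᶜ.filter fun u => b u = b (s x) ∧ ¬ D.Adj (s x) (s u) ∧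
    ¬ D.Adj u x) with hE2
  have e1 : E1 = ∅ := card_eq_zero.1 (by omega)
  have e2 : E2 = ∅ := card_eq_zero.1 (by omega)
  rw [e1, card_empty] at c1
  rw [e2, card_empty] at c2
  have mx : D.miss b x = a - 1 := by unfold miss; omega
  have my : D.miss b (s x) = a - 1 := by unfold miss; omega
  have iff1 : ∀ u, b u = b x → u ≠ x → (D.Adj x (s u) ↔ ¬ D.Adj u (s x)) := by
    intro u hu hux
    have hu2 : u ∉ ({x, s x} : Finset V) := by
      simp only [mem_insert, mem_singleton, not_or]
      exact ⟨hux, fun h => hbx (by rw [← h, hu])⟩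
    refine ⟨h.not_adj x (by simp) u hu2, fun h1 => ?_⟩
    by_contra h2
    have : u ∈ E1 := by
      rw [hE1, mem_filter, mem_compl]; exact ⟨hu2, hu, h2, h1⟩
    rw [e1] at this
    simp at this
  have iff2 : ∀ u, b u ≠ b x → u ≠ s x → (D.Adj (s x) (s u) ↔ ¬ D.Adj u x) := by
    intro u hu hux
    have hu2 : u ∉ ({x, s x} : Finset V) := by
      simp only [mem_insert, mem_singleton, not_or]
      exact ⟨fun h => hu (by rw [h]), hux⟩
    have h0 := h.not_adj (s x) (by simp) u hu2
    rw [hxx] at h0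
    refine ⟨h0, fun h1 => ?_⟩
    by_contra h2
    have : u ∈ E2 := by
      rw [hE2, mem_filter, mem_compl]
      refine ⟨hu2, ?_, h2, h1⟩
      cases h1 : b u <;> cases h2 : b x <;> cases h3 : b (s x) <;> simp_all
    rw [e2] at this
    simp at this
  have hdom : ∀ u v, D.IsDominatingPair u v → D.miss b u = a - 1 → D.miss b v ≤ 2 := by
    intro u v huv hu
    rcases hP u v huv with h | h <;> omega
  refine ⟨mx, iff1, iff2, ?_, by omega, ?_, ?_⟩
  · intro u hux huy
    by_cases hu : b u = b x
    · by_cases hA : D.Adj x (s u)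
      · exact hdom x u ⟨hux.symm, s u, hA, hs u⟩ mx
      · have := not_not.1 (fun hn => hA ((iff1 u hu hux).2 hn))
        exact hdom x u ⟨hux.symm, s x, hs x, this⟩ mx
    · by_cases hA : D.Adj (s x) (s u)
      · exact hdom (s x) u ⟨huy.symm, s u, hA, hs u⟩ my
      · have := not_not.1 (fun hn => hA ((iff2 u hu huy).2 hn))
        have hxs := hs (s x)
        rw [hxx] at hxs
        exact hdom (s x) u ⟨huy.symm, x, hxs, this⟩ my
  -- With no missing in-arc, `x` and `s x` spend all their missing arcs on out-arcs, so nothing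
  -- would leave the 2-cycle. The last bullet is the reverse situation, where nothing enters.
  · by_contra hcon
    have g1 : D.missOut b {x, s x}ᶜ x = a - 1 := by omega
    have g2 : D.missOut b {x, s x}ᶜ (s x) = a - 1 := by omega
    have key : ∀ v, ((({x, s x} : Finset V)ᶜ.filter fun w => b w ≠ b v).card = a - 1) →
        D.missOut b {x, s x}ᶜ v = a - 1 → ¬ D.Adj v q := by
      intro v hv hm hvq
      have hlt : D.missOut b {x, s x}ᶜ v < (({x, s x} : Finset V)ᶜ.filter fun w => b w ≠ b v).card := by
        refine card_lt_card ?_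
        rw [Finset.ssubset_iff_of_subset]
        · refine ⟨q, ?_, ?_⟩
          · simp only [mem_filter, mem_compl]
            exact ⟨by simpa using hq', (hb.ne_of_adj hvq).symm⟩
          · simp [hvq]
        · intro w; simp only [mem_filter]; tauto
      omega
    rcases hp' with rfl | rfl
    · refine key p ?_ g1 hpq
      rw [← hcard']; congr 1; ext w
      simp only [mem_filter]
      cases h1 : b w <;> cases h2 : b p <;> cases h3 : b (s p) <;> simp_all
    · refine key _ ?_ g2 hpq
      rw [← hcard]; congr 1; ext w
      simp only [mem_filter]
      cases h1 : b w <;> cases h2 : b x <;> cases h3 : b (s x) <;> simp_all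
  · by_contra hcon
    have g1 : D.missIn b {x, s x}ᶜ x = a - 1 := by omega
    have g2 : D.missIn b {x, s x}ᶜ (s x) = a - 1 := by omega
    obtain ⟨q, hq, r, hr, hqr⟩ := hD.exists_adj_of_mem
      ((({x, s x} : Finset V)ᶜ : Finset V) : Set V)
      (x := z) (y := x) (by simpa [and_comm] using hz.1) (by simp)
    have hq' : q ≠ x ∧ q ≠ s x := by simpa [and_comm] using hq
    have hr' : r = x ∨ r = s x := by simpa [or_iff_not_imp_right] using hr
    have key : ∀ v, ((({x, s x} : Finset V)ᶜ.filter fun w => b w ≠ b v).card = a - 1) →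
        D.missIn b {x, s x}ᶜ v = a - 1 → ¬ D.Adj q v := by
      intro v hv hm hvq
      have hlt : D.missIn b {x, s x}ᶜ v < (({x, s x} : Finset V)ᶜ.filter fun w => b w ≠ b v).card := by
        refine card_lt_card ?_
        rw [Finset.ssubset_iff_of_subset]
        · refine ⟨q, ?_, ?_⟩
          · simp only [mem_filter, mem_compl]
            exact ⟨by simpa using hq', hb.ne_of_adj hvq⟩
          · simp [hvq]
        · intro w; simp only [mem_filter]; tauto
      omega
    rcases hr' with rfl | rfl
    · refine key r ?_ g1 hqr
      rw [← hcard']; congr 1; ext w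
      simp only [mem_filter]
      cases h1 : b w <;> cases h2 : b r <;> cases h3 : b (s r) <;> simp_all
    · refine key _ ?_ g2 hqr
      rw [← hcard]; congr 1; ext w
      simp only [mem_filter]
      cases h1 : b w <;> cases h2 : b x <;> cases h3 : b (s x) <;> simp_all

end TwoCycle

/-! ### Existence of a cycle factor, with `H₂` as the exception. -/

section Hall
variable {V : Type*} [Fintype V] [DecidableEq V] {D : Digraph V} {b : V → Bool} {a : ℕ}

theorem isIsomorphic_of_bijective {W : Type*} {H : Digraph W} (f : W → V)
    (hf : Function.Bijective f) (h : ∀ u v, H.Adj u v ↔ D.Adj (f u) (f v)) :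
    D.IsIsomorphic H :=
  ⟨RelIso.symm ⟨Equiv.ofBijective f hf, fun {u v} => (h u v).symm⟩⟩

theorem IsBicoloring.not_adj (hb : D.IsBicoloring b a) {u v : V} (h : b u = b v) :
    ¬ D.Adj u v := fun h' => hb.ne_of_adj h' h

theorem IsBicoloring.mem_of_le_card (hb : D.IsBicoloring b a) {A : Finset V} {i : Bool}
    (hA : ∀ v ∈ A, b v = i) (h : a ≤ A.card) {v : V} (hv : b v = i) : v ∈ A := by
  have : A = univ.filter (b · = i) :=
    eq_of_subset_of_card_le (fun w hw => by simpa using hA w hw) (by rw [hb.card_eq]; exact h)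
  rw [this]; simpa using hv

theorem IsBicoloring.card_eq_two_mul (hb : D.IsBicoloring b a) : Fintype.card V = 2 * a := by
  rw [← card_univ, ← card_filter_add_card_filter_not (s := univ) (fun v => b v = true),
    hb.card_eq, two_mul]
  have := hb.card_eq false
  simp only [Bool.not_eq_true]
  omega

theorem IsStrong.exists_adj [Nontrivial V] (hD : D.IsStrong) (v : V) : ∃ w, D.Adj v w := by
  obtain ⟨w, hw⟩ := exists_ne v
  obtain ⟨u, hu, z, -, huz⟩ := hD.exists_adj_of_mem {v} (x := v) (y := w) rfl hw
  rw [Set.mem_singleton_iff] at hu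
  exact ⟨z, hu ▸ huz⟩

theorem IsStrong.exists_adj_left [Nontrivial V] (hD : D.IsStrong) (v : V) : ∃ w, D.Adj w v := by
  obtain ⟨w, hw⟩ := exists_ne v
  obtain ⟨u, -, z, hz, huz⟩ := hD.exists_adj_of_mem {v}ᶜ (x := w) (y := v) hw (by simp)
  simp only [Set.mem_compl_iff, Set.mem_singleton_iff, not_not] at hz
  exact ⟨u, hz ▸ huz⟩

theorem adj_of_missIn_eq_zero {S : Finset V} {v w : V} (h : D.missIn b S v = 0) (hw : w ∈ S)
    (hne : b w ≠ b v) : D.Adj w v := by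
  by_contra hcon
  have := card_le_missIn (D := D) (b := b) (S := S) (A := {w}) (v := v) (by simpa using hw)
    (by simpa using ⟨hne, hcon⟩)
  simp at this
  omega

theorem adj_of_missOut_eq_zero {S : Finset V} {v w : V} (h : D.missOut b S v = 0) (hw : w ∈ S)
    (hne : b w ≠ b v) : D.Adj v w := by
  by_contra hcon
  have := card_le_missOut (D := D) (b := b) (S := S) (A := {w}) (v := v) (by simpa using hw)
    (by simpa using ⟨hne, hcon⟩)
  simp at this
  omega

/-- The digraphs `digraphH2`, recognised inside a digraph on six vertices. -/
theorem isIsomorphic_digraphH2 (hb : D.IsBicoloring b 3) {x y z n u v : V}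
    (hxy : x ≠ y) (hxz : x ≠ z) (hyz : y ≠ z) (hnu : n ≠ u) (hnv : n ≠ v) (huv : u ≠ v)
    (by_ : b y = b x) (bz : b z = b x) (bn : b n = !b x) (bu : b u = !b x) (bv : b v = !b x)
    (h1 : D.Adj x n) (h2 : D.Adj n x) (h3 : D.Adj y n) (h4 : D.Adj n y)
    (h5 : D.Adj z u) (h6 : D.Adj u z) (h7 : D.Adj z v) (h8 : D.Adj v z)
    (h9 : D.Adj u x) (h10 : D.Adj u y) (h11 : D.Adj v x) (h12 : D.Adj v y) (h13 : D.Adj n z)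
    (k1 : ¬ D.Adj x u) (k2 : ¬ D.Adj x v) (k3 : ¬ D.Adj y u) (k4 : ¬ D.Adj y v) :
    D.IsIsomorphic (digraphH2 (D.Adj z n)) := by
  have e1 : ∀ w, b w = b x → w ∈ ({x, y, z} : Finset V) := fun w hw =>
    hb.mem_of_le_card (i := b x) (by simp [by_, bz]) (by rw [card_eq_three.2 ⟨x, y, z, hxy, hxz, hyz, rfl⟩]) hw
  have e2 : ∀ w, b w = !b x → w ∈ ({n, u, v} : Finset V) := fun w hw =>
    hb.mem_of_le_card (i := !b x) (by simp [bn, bu, bv]) (by rw [card_eq_three.2 ⟨n, u, v, hnu, hnv, huv, rfl⟩]) hw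
  have hs : ∀ p q, b p = b q → ¬ D.Adj p q := fun p q h => hb.not_adj h
  refine isIsomorphic_of_bijective (Sum.elim ![x, y, z] ![n, u, v]) ?_ ?_
  · rw [Fintype.bijective_iff_surjective_and_card]
    refine ⟨fun w => ?_, by simp [hb.card_eq_two_mul]⟩
    rcases Bool.eq_or_eq_not (b w) (b x) with h | h
    · have := e1 w h
      simp only [mem_insert, mem_singleton] at this
      rcases this with rfl | rfl | rfl
      exacts [⟨Sum.inl 0, rfl⟩, ⟨Sum.inl 1, rfl⟩, ⟨Sum.inl 2, rfl⟩]
    · have := e2 w h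
      simp only [mem_insert, mem_singleton] at this
      rcases this with rfl | rfl | rfl
      exacts [⟨Sum.inr 0, rfl⟩, ⟨Sum.inr 1, rfl⟩, ⟨Sum.inr 2, rfl⟩]
  · rintro (i | i) (j | j) <;> fin_cases i <;> fin_cases j <;>
      simp [digraphH2, h1, h2, h3, h4, h5, h6, h7, h8, h9, h10, h11, h12, h13, k1, k2, k3, k4,
        hs, by_, bz, bn, bu, bv]

-- A deficient set `T` contains a dominating pair, hence a vertex `x` lacking at most 2 arcs; it
-- lacks every out-arc to the vertices outside `N`. This pins down the sizes of `T` and `N`, then `a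
-- = 3`, and then every arc except the optional one from `z` to `n`.
set_option maxHeartbeats 800000 in
theorem isIsomorphic_digraphH2_of_card_lt (ha : 2 ≤ a) (hb : D.IsBicoloring b a)
    (hP : D.PairCondition b a) (hD : D.IsStrong) {T N : Finset V} {i : Bool}
    (hT : ∀ v ∈ T, b v = i) (hN : ∀ w, w ∈ N ↔ ∃ v ∈ T, D.Adj v w) (hlt : N.card < T.card) :
    ∃ p, D.IsIsomorphic (digraphH2 p) := by
  classical
  have : Nontrivial V := Fintype.one_lt_card_iff_nontrivial.1 (by rw [hb.card_eq_two_mul]; omega)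
  have hNc : ∀ w ∈ N, b w = !i := by
    intro w hw
    obtain ⟨v, hv, hvw⟩ := (hN w).1 hw
    rw [hb.color_right hvw, hT v hv]
  have hTsub : T ⊆ univ.filter (b · = i) := fun v hv => by simpa using hT v hv
  have hNsub : N ⊆ univ.filter (b · = !i) := fun v hv => by simpa using hNc v hv
  obtain ⟨x, y, hx, hy, hxy, hdom⟩ : ∃ x y, x ∈ T ∧ y ∈ T ∧ D.miss b x ≤ 2 ∧
      D.IsDominatingPair x y := by
    choose f hf using hD.exists_adj
    obtain ⟨x, hx, y, hy, hne, hxy⟩ := exists_ne_map_eq_of_card_lt_of_maps_to hlt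
      (f := f) (fun v hv => (hN _).2 ⟨v, hv, hf v⟩)
    have hd : D.IsDominatingPair x y := ⟨hne, f x, hf x, by rw [hxy]; exact hf y⟩
    rcases hP.or hd with h | h
    · exact ⟨x, y, hx, hy, h, hd⟩
    · exact ⟨y, x, hy, hx, h, hne.symm, f x, hd.2.elim fun _ _ => by rw [hxy]; exact hf y, hf x⟩
  have hout : ∀ v ∈ T, a - N.card ≤ D.missOut b univ v := by
    intro v hv
    rw [← hb.card_eq (!i), ← card_sdiff_of_subset hNsub]
    refine card_le_missOut (subset_univ _) fun w hw => ?_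
    simp only [mem_sdiff, mem_filter, mem_univ, true_and] at hw
    refine ⟨by rw [hw.1, hT v hv]; simp, fun h => hw.2 ((hN w).2 ⟨v, hv, h⟩)⟩
  have hTa : T.card ≤ a := by rw [← hb.card_eq i]; exact card_le_card hTsub
  -- If `T` were a whole colour class, strong connectivity would make `N` the whole other class.
  have hTa' : T.card ≠ a := by
    intro h
    have hlt' : N.card < (univ.filter (b · = !i)).card := by rw [hb.card_eq]; omega
    obtain ⟨z, hz, hzN⟩ := exists_mem_notMem_of_card_lt_card hlt'
    obtain ⟨w, hw⟩ := hD.exists_adj_left z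
    apply hzN
    refine (hN z).2 ⟨w, hb.mem_of_le_card hT h.ge ?_, hw⟩
    rw [hb.color_left hw, (mem_filter.1 hz).2, Bool.not_not]
  have hxo := hout x hx
  have hmx := hxy
  unfold miss at hmx
  -- Since `x` lacks at least `a - N.card` out-arcs, `a - 2 ≤ N.card < T.card ≤ a - 1`. Both sizes
  -- are thus determined, and `x` lacks no in-arc.
  have hTc : T.card = a - 1 := by omega
  have hNcard : N.card = a - 2 := by omega
  have h2T : 1 < T.card := one_lt_card.2 ⟨x, hx, y, hy, hdom.1⟩
  obtain ⟨y₁, y₂, hy12, hY⟩ := card_eq_two.1 (show ((univ.filter (b · = !i)) \ N).card = 2 by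
    rw [card_sdiff_of_subset hNsub, hb.card_eq]; omega)
  obtain ⟨z, hz⟩ := card_eq_one.1 (show ((univ.filter (b · = i)) \ T).card = 1 by
    rw [card_sdiff_of_subset hTsub, hb.card_eq]; omega)
  have hz' : b z = i ∧ z ∉ T := by
    have : z ∈ (univ.filter (b · = i)) \ T := by rw [hz]; simp
    simpa using this
  have hY' : ∀ w, w = y₁ ∨ w = y₂ → b w = (!i) ∧ w ∉ N := by
    intro w hw
    have : w ∈ (univ.filter (b · = !i)) \ N := by rw [hY]; simpa using hw
    simpa using this
  have hin : ∀ w, w = y₁ ∨ w = y₂ → a - 1 ≤ D.missIn b univ w := by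
    intro w hw
    rw [← hTc]
    refine card_le_missIn (subset_univ _) fun v hv => ?_
    exact ⟨by rw [hT v hv, (hY' w hw).1]; simp, fun h => (hY' w hw).2 ((hN w).2 ⟨v, hv, h⟩)⟩
  have hyx : ∀ w, w = y₁ ∨ w = y₂ → D.Adj w x := fun w hw =>
    adj_of_missIn_eq_zero (b := b) (by omega) (mem_univ w) (by rw [hT x hx, (hY' w hw).1]; simp)
  have hd12 : D.IsDominatingPair y₁ y₂ := ⟨hy12, x, hyx _ (Or.inl rfl), hyx _ (Or.inr rfl)⟩
  have ha3 : a = 3 := by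
    have h1 := hin y₁ (Or.inl rfl)
    have h2 := hin y₂ (Or.inr rfl)
    -- Both `y₁` and `y₂` lack the `a - 1` in-arcs from `T`, yet one of them lacks at most 2 arcs;
    -- and `a ≥ 3` because `T` has two elements.
    rcases hP.or hd12 with h | h <;> unfold miss at h <;> omega
  subst ha3
  obtain ⟨n, hn⟩ := card_eq_one.1 (show N.card = 1 by omega)
  have hTeq : T = {x, y} := (eq_of_subset_of_card_le (by
    intro w hw
    simp only [mem_insert, mem_singleton] at hw
    rcases hw with rfl | rfl <;> assumption) (by rw [card_pair hdom.1]; omega)).symm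
  have hmy : D.miss b y ≤ 2 := hP.le le_rfl ⟨hdom.1.symm, hdom.2.imp fun _ h => h.symm⟩
  have hyo := hout y hy
  have hmy' := hmy
  unfold miss at hmy'
  have inx : D.missIn b univ x = 0 := by omega
  have iny : D.missIn b univ y = 0 := by omega
  have hout1 : ∀ w, w = y₁ ∨ w = y₂ → D.missOut b univ w = 0 := by
    intro w hw
    have h1 := hin w hw
    have h2 : D.miss b w ≤ 2 := by
      rcases hw with rfl | rfl
      · exact hP.le le_rfl hd12
      · exact hP.le le_rfl ⟨hd12.1.symm, hd12.2.imp fun _ h => h.symm⟩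
    unfold miss at h2
    omega
  have hbn : b n = !i := hNc n (by rw [hn]; simp)
  have hTn : ∀ v ∈ T, ∀ w, D.Adj v w → w = n := by
    intro v hv w hw
    have := (hN w).2 ⟨v, hv, hw⟩
    rw [hn] at this
    simpa using this
  have hTn' : ∀ v ∈ T, D.Adj v n := by
    intro v hv
    obtain ⟨w, hw⟩ := hD.exists_adj v
    exact hTn v hv w hw ▸ hw
  have hcol : ∀ w, b w = i → w ∉ T → w = z := by
    intro w hw hwT
    have : w ∈ (univ.filter (b · = i)) \ T := by simpa using ⟨hw, hwT⟩
    rw [hz] at this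
    simpa using this
  have hzy : ∀ w, w = y₁ ∨ w = y₂ → D.Adj z w := by
    intro w hw
    obtain ⟨v, hv⟩ := hD.exists_adj_left w
    have hvT : v ∉ T := fun h => (hY' w hw).2 ((hN w).2 ⟨v, h, hv⟩)
    have : b v = i := by rw [hb.color_left hv, (hY' w hw).1, Bool.not_not]
    exact hcol v this hvT ▸ hv
  have hnz : D.Adj n z := by
    obtain ⟨u, hu, v, hv, huv⟩ := hD.exists_adj_of_mem (insert n (T : Set V)) (x := x) (y := z)
      (by simp [hx]) (by
        simp only [Set.mem_insert_iff, mem_coe, not_or]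
        refine ⟨?_, hz'.2⟩
        rintro rfl
        rw [hz'.1] at hbn; simp at hbn)
    simp only [Set.mem_insert_iff, mem_coe, not_or] at hu hv
    rcases hu with rfl | hu
    · have : b v = i := by rw [hb.color_right huv, hbn, Bool.not_not]
      exact hcol v this hv.2 ▸ huv
    · exact absurd (hTn u hu v huv) hv.1
  have nadj : ∀ v ∈ T, ∀ w, w = y₁ ∨ w = y₂ → ¬ D.Adj v w := fun v hv w hw h =>
    (hY' w hw).2 ((hN w).2 ⟨v, hv, h⟩)
  have bx := hT x hx
  have b_y := hT y hy
  have bz := hz'.1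
  have b1 := (hY' y₁ (Or.inl rfl)).1
  have b2 := (hY' y₂ (Or.inr rfl)).1
  have hnN : n ∈ N := by rw [hn]; simp
  refine ⟨D.Adj z n, isIsomorphic_digraphH2 hb (x := x) (y := y) (z := z) (n := n) (u := y₁)
    (v := y₂) hdom.1 ?_ ?_ ?_ ?_ hy12 (by rw [bx, b_y]) (by rw [bz, bx]) (by rw [hbn, bx])
    (by rw [b1, bx]) (by rw [b2, bx]) (hTn' x hx)
    (adj_of_missIn_eq_zero inx (mem_univ _) (by rw [hbn, bx]; simp)) (hTn' y hy)
    (adj_of_missIn_eq_zero iny (mem_univ _) (by rw [hbn, b_y]; simp))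
    (hzy _ (Or.inl rfl))
    (adj_of_missOut_eq_zero (hout1 y₁ (Or.inl rfl)) (mem_univ _) (by rw [b1, bz]; simp))
    (hzy _ (Or.inr rfl))
    (adj_of_missOut_eq_zero (hout1 y₂ (Or.inr rfl)) (mem_univ _) (by rw [b2, bz]; simp))
    (hyx _ (Or.inl rfl))
    (adj_of_missOut_eq_zero (hout1 y₁ (Or.inl rfl)) (mem_univ _) (by rw [b1, b_y]; simp))
    (hyx _ (Or.inr rfl))
    (adj_of_missOut_eq_zero (hout1 y₂ (Or.inr rfl)) (mem_univ _) (by rw [b2, b_y]; simp))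
    hnz (nadj x hx _ (Or.inl rfl)) (nadj x hx _ (Or.inr rfl)) (nadj y hy _ (Or.inl rfl))
    (nadj y hy _ (Or.inr rfl))⟩
  · rintro rfl; exact hz'.2 hx
  · rintro rfl; exact hz'.2 hy
  · rintro rfl; exact (hY' n (Or.inl rfl)).2 hnN
  · rintro rfl; exact (hY' n (Or.inr rfl)).2 hnN

theorem exists_isFactor_or_isIsomorphic_digraphH2 (ha : 2 ≤ a) (hb : D.IsBicoloring b a)
    (hP : D.PairCondition b a) (hD : D.IsStrong) :
    (∃ s, D.IsFactor s) ∨ ∃ p, D.IsIsomorphic (digraphH2 p) := by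
  classical
  by_cases h : ∀ S : Finset V, S.card ≤ (S.biUnion fun v => univ.filter (D.Adj v)).card
  · left
    obtain ⟨f, hf, hadj⟩ := (Finset.all_card_le_biUnion_card_iff_exists_injective _).1 h
    refine ⟨Equiv.ofBijective f (Finite.injective_iff_bijective.1 hf), fun v => ?_⟩
    simpa using hadj v
  · right
    push Not at h
    obtain ⟨S, hS⟩ := h
    -- The two colour classes of a Hall violator have disjoint out-neighbourhoods, so one class is
    -- itself a violator.
    by_cases h1 : ∃ i, ((S.filter (b · = i)).biUnion fun v => univ.filter (D.Adj v)).card <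
        (S.filter (b · = i)).card
    · obtain ⟨i, hi⟩ := h1
      refine isIsomorphic_digraphH2_of_card_lt ha hb hP hD (i := i) ?_ ?_ hi
      · intro v hv; exact (mem_filter.1 hv).2
      · intro w; simp
    · push Not at h1
      exfalso
      have hS1 : S.filter (b · = true) ∪ S.filter (b · = false) = S := by
        ext v; simp only [mem_union, mem_filter]; cases b v <;> simp
      have hd : Disjoint (S.filter (b · = true)) (S.filter (b · = false)) := by
        rw [disjoint_filter]; intro v _ h1 h2; simp [h1] at h2
      have hd2 : Disjoint ((S.filter (b · = true)).biUnion fun v => univ.filter (D.Adj v))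
          ((S.filter (b · = false)).biUnion fun v => univ.filter (D.Adj v)) := by
        rw [Finset.disjoint_left]
        intro w hw1 hw2
        simp only [mem_biUnion, mem_filter, mem_univ, true_and] at hw1 hw2
        obtain ⟨u, hu, huw⟩ := hw1
        obtain ⟨v, hv, hvw⟩ := hw2
        have e1 := hb.ne_of_adj huw
        have e2 := hb.ne_of_adj hvw
        rw [hu.2] at e1
        rw [hv.2] at e2
        cases h : b w <;> simp_all
      have e := card_union_of_disjoint hd2
      rw [← union_biUnion, hS1] at e
      have e3 := card_union_of_disjoint hd
      rw [hS1] at e3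
      have := h1 true
      have := h1 false
      omega

end Hall

/-! ### The cases `a = 2` and `a = 3`, with `H₁` and `H₃` as exceptions. -/

section Small
variable {V : Type*} [Fintype V] [DecidableEq V] {D : Digraph V} {b : V → Bool} {a : ℕ}

theorem isHamiltonian_of_isChain {x : V} {t : List V} (ht : t ≠ [])
    (hV : Fintype.card V = t.length + 1) (hmem : ∀ v, v ∈ x :: t)
    (h : List.IsChain D.Adj (x :: t ++ [x])) : D.IsHamiltonian := by
  have hlen : 0 < t.length := List.length_pos_iff.2 ht
  refine isHamiltonian_of_closedWalk (n := t.length + 1)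
    (fun i => (x :: t)[i.val]'(by simpa using ZMod.val_lt i)) (by omega) hV ?_ ?_
  · intro i
    have hi := ZMod.val_lt i
    have h1 := (List.isChain_iff_getElem.1 h) i.val (by simp; omega)
    rw [List.getElem_append_left (by simpa using hi)] at h1
    have h3 : (i + 1).val = (i.val + 1) % (t.length + 1) := by
      rw [ZMod.val_add, ZMod.val_one_eq_one_mod, Nat.add_mod_mod]
    by_cases hlast : i.val = t.length
    · have h4 : (i + 1).val = 0 := by rw [h3, hlast, Nat.mod_self]
      simp only [h4]
      rw [List.getElem_append_right (by simp; omega)] at h1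
      simpa using h1
    · have h4 : (i + 1).val = i.val + 1 := by rw [h3, Nat.mod_eq_of_lt (by omega)]
      simp only [h4]
      rw [List.getElem_append_left (by simp; omega)] at h1
      exact h1
  · intro v
    obtain ⟨k, hk, hv⟩ := List.getElem_of_mem (hmem v)
    refine ⟨(k : ZMod (t.length + 1)), ?_⟩
    have : (k : ZMod (t.length + 1)).val = k := ZMod.val_cast_of_lt (by simpa using hk)
    simp only [this]
    exact hv

theorem IsBicoloring.eq_or_eq_or_eq (hb : D.IsBicoloring b 3) {x y z v : V} (hxy : x ≠ y)
    (hxz : x ≠ z) (hyz : y ≠ z) (by_ : b y = b x) (bz : b z = b x) (hv : b v = b x) :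
    v = x ∨ v = y ∨ v = z := by
  have := hb.mem_of_le_card (i := b x) (A := {x, y, z}) (by simp [by_, bz])
    (by rw [card_eq_three.2 ⟨x, y, z, hxy, hxz, hyz, rfl⟩]) hv
  simpa using this

theorem IsBicoloring.eq_or_eq (hb : D.IsBicoloring b 2) {x y v : V} (hxy : x ≠ y)
    (by_ : b y = b x) (hv : b v = b x) : v = x ∨ v = y := by
  have := hb.mem_of_le_card (i := b x) (A := {x, y}) (by simp [by_])
    (by rw [card_pair hxy]) hv
  simpa using this

theorem IsBicoloring.color_apply (hb : D.IsBicoloring b a) {s : Perm V} (hs : D.IsFactor s)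
    (v : V) : b (s v) = !b v := hb.color_right (hs v)

theorem IsFactor.isHamiltonian_or_exists (ha : 2 ≤ a) (hb : D.IsBicoloring b a) {s : Perm V}
    (hs : D.IsFactor s) :
    D.IsHamiltonian ∨ ∃ p q, ¬ s.SameCycle p q ∧ b q = b p := by
  by_cases h : ∀ p q, s.SameCycle p q
  · exact Or.inl (hs.isHamiltonian h (by rw [hb.card_eq_two_mul]; omega))
  · right
    push Not at h
    obtain ⟨p, q, hpq⟩ := h
    rcases Bool.eq_or_eq_not (b q) (b p) with h | h
    · exact ⟨p, q, hpq, h⟩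
    · exact ⟨p, s q, by rwa [sameCycle_apply_right], by rw [hb.color_apply hs, h, Bool.not_not]⟩

theorem sameCycle_apply_apply {s : Perm V} (p : V) : s.SameCycle p (s (s p)) := by
  rw [sameCycle_apply_right, sameCycle_apply_right]

theorem isIsomorphic_digraphH1 (hb : D.IsBicoloring b 2) {x₁ y₁ x₂ y₂ : V}
    (hx : x₁ ≠ x₂) (hy : y₁ ≠ y₂) (b2 : b x₂ = b x₁) (c1 : b y₁ = !b x₁) (c2 : b y₂ = !b x₁)
    (h1 : D.Adj x₁ y₁) (h2 : D.Adj y₁ x₁) (h3 : D.Adj x₂ y₁) (h4 : D.Adj y₁ x₂)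
    (h5 : D.Adj x₂ y₂) (h6 : D.Adj y₂ x₂) (k1 : ¬ D.Adj x₁ y₂) (k2 : ¬ D.Adj y₂ x₁) :
    D.IsIsomorphic digraphH1 := by
  have hs : ∀ p q, b p = b q → ¬ D.Adj p q := fun p q h => hb.not_adj h
  refine isIsomorphic_of_bijective (Sum.elim ![x₁, x₂] ![y₁, y₂]) ?_ ?_
  · rw [Fintype.bijective_iff_surjective_and_card]
    refine ⟨fun w => ?_, by simp [hb.card_eq_two_mul]⟩
    rcases Bool.eq_or_eq_not (b w) (b x₁) with h | h
    · rcases hb.eq_or_eq hx b2 h with rfl | rfl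
      exacts [⟨Sum.inl 0, rfl⟩, ⟨Sum.inl 1, rfl⟩]
    · rcases hb.eq_or_eq hy (by rw [c1, c2]) (by rw [h, c1]) with rfl | rfl
      exacts [⟨Sum.inr 0, rfl⟩, ⟨Sum.inr 1, rfl⟩]
  · rintro (i | i) (j | j) <;> fin_cases i <;> fin_cases j <;>
      simp [digraphH1, h1, h2, h3, h4, h5, h6, k1, k2, hs, b2, c1, c2]

theorem isIsomorphic_digraphH3 (hb : D.IsBicoloring b 3) {x₁ x₂ x₃ y₁ y₂ y₃ : V}
    (hx12 : x₁ ≠ x₂) (hx13 : x₁ ≠ x₃) (hx23 : x₂ ≠ x₃)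
    (hy12 : y₁ ≠ y₂) (hy13 : y₁ ≠ y₃) (hy23 : y₂ ≠ y₃)
    (b2 : b x₂ = b x₁) (b3 : b x₃ = b x₁)
    (c1 : b y₁ = !b x₁) (c2 : b y₂ = !b x₁) (c3 : b y₃ = !b x₁)
    (h1 : D.Adj x₁ y₂) (h2 : D.Adj y₂ x₂) (h3 : D.Adj x₂ y₁) (h4 : D.Adj y₁ x₁)
    (h5 : D.Adj x₁ y₃) (h6 : D.Adj y₃ x₁) (h7 : D.Adj x₂ y₃) (h8 : D.Adj y₃ x₂)
    (h9 : D.Adj x₃ y₁) (h10 : D.Adj y₁ x₃) (h11 : D.Adj x₃ y₂) (h12 : D.Adj y₂ x₃)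
    (k1 : ¬ D.Adj y₂ x₁) (k2 : ¬ D.Adj x₂ y₂) (k3 : ¬ D.Adj y₁ x₂) (k4 : ¬ D.Adj x₁ y₁)
    (k5 : ¬ D.Adj x₃ y₃) (k6 : ¬ D.Adj y₃ x₃) : D.IsIsomorphic digraphH3 := by
  have hs : ∀ p q, b p = b q → ¬ D.Adj p q := fun p q h => hb.not_adj h
  refine isIsomorphic_of_bijective (Sum.elim ![x₁, x₂, x₃] ![y₁, y₂, y₃]) ?_ ?_
  · rw [Fintype.bijective_iff_surjective_and_card]
    refine ⟨fun w => ?_, by simp [hb.card_eq_two_mul]⟩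
    rcases Bool.eq_or_eq_not (b w) (b x₁) with h | h
    · rcases hb.eq_or_eq_or_eq hx12 hx13 hx23 b2 b3 h with rfl | rfl | rfl
      exacts [⟨Sum.inl 0, rfl⟩, ⟨Sum.inl 1, rfl⟩, ⟨Sum.inl 2, rfl⟩]
    · rcases hb.eq_or_eq_or_eq hy12 hy13 hy23 (by rw [c1, c2]) (by rw [c1, c3])
        (by rw [h, c1]) with rfl | rfl | rfl
      exacts [⟨Sum.inr 0, rfl⟩, ⟨Sum.inr 1, rfl⟩, ⟨Sum.inr 2, rfl⟩]
  · rintro (i | i) (j | j) <;> fin_cases i <;> fin_cases j <;>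
      simp [digraphH3, h1, h2, h3, h4, h5, h6, h7, h8, h9, h10, h11, h12, k1, k2, k3, k4, k5, k6,
        hs, b2, b3, c1, c2, c3]

/-- A factor with more than one cycle consists of two 2-cycles. Strong connectivity supplies an arc
each way between them. If these two arcs have different sets of ends, the cycles merge; so they join
the same two vertices, and unmergeability excludes the remaining arcs. -/
theorem isHamiltonian_or_isIsomorphic_digraphH1 (hb : D.IsBicoloring b 2) (hD : D.IsStrong)
    {s : Perm V} (hs : D.IsFactor s) (hu : D.IsUnmergeable s) :
    D.IsHamiltonian ∨ D.IsIsomorphic digraphH1 := by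
  refine (hs.isHamiltonian_or_exists le_rfl hb).imp_right ?_
  rintro ⟨p, q, hpq, hbq⟩
  have two : ∀ p q, ¬ s.SameCycle p q → b q = b p → s (s p) = p := by
    intro p q hpq hbq
    have hne : p ≠ q := by rintro rfl; exact hpq (SameCycle.refl _ _)
    rcases hb.eq_or_eq hne hbq (v := s (s p)) (by simp [hb.color_apply hs]) with h | h
    · exact h
    · exact absurd (h ▸ sameCycle_apply_apply p) hpq
  have key : ∀ p q, ¬ s.SameCycle p q → b q = b p → D.Adj p (s q) → D.Adj (s q) p →
      D.IsIsomorphic digraphH1 := by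
    intro p q hpq hbq h1 h2
    have hne : p ≠ q := by rintro rfl; exact hpq (SameCycle.refl _ _)
    have hp := two p q hpq hbq
    have hq := two q p (fun h => hpq h.symm) hbq.symm
    have e1 := hs (s p)
    have e2 := hs (s q)
    rw [hp] at e1
    rw [hq] at e2
    have n1 := hu p q hpq h1
    have n2 := hu (s q) (s p) (by rw [sameCycle_apply_left, sameCycle_apply_right]; exact fun h => hpq h.symm)
      (by rwa [hp])
    rw [hq] at n2
    exact isIsomorphic_digraphH1 hb (x₁ := q) (y₁ := s q) (x₂ := p) (y₂ := s p) hne.symm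
      (fun h => hne (s.injective h).symm) hbq.symm (hb.color_apply hs q)
      (by rw [hb.color_apply hs, hbq]) (hs q) e2 h1 h2 (hs p) e1 n1 n2
  have hne : p ≠ q := by rintro rfl; exact hpq (SameCycle.refl _ _)
  have hp := two p q hpq hbq
  have hq := two q p (fun h => hpq h.symm) hbq.symm
  have hqsp : q ≠ s p := fun h => by
    have := hb.color_apply hs p
    rw [← h, hbq] at this
    simp at this
  have hcase : ∀ v, v ∉ ({p, s p} : Set V) → v = q ∨ v = s q := by
    intro v hv
    simp only [Set.mem_insert_iff, Set.mem_singleton_iff, not_or] at hv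
    rcases Bool.eq_or_eq_not (b v) (b p) with h | h
    · rcases hb.eq_or_eq hne hbq h with h | h
      · exact absurd h hv.1
      · exact Or.inl h
    · rcases hb.eq_or_eq (x := s p) (y := s q) (fun h => hne (s.injective h))
        (by simp [hb.color_apply hs, hbq]) (v := v) (by rw [h, hb.color_apply hs]) with h | h
      · exact absurd h hv.2
      · exact Or.inr h
  obtain ⟨u, hu1, v, hv1, huv⟩ := hD.exists_adj_of_mem {p, s p} (x := p) (y := q) (by simp)
    (by simpa using ⟨hne.symm, hqsp⟩)
  obtain ⟨z, hz1, w, hw1, hzw⟩ := hD.exists_adj_of_mem {p, s p}ᶜ (x := q) (y := p)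
    (by simpa using ⟨hne.symm, hqsp⟩) (by simp)
  have hz2 := hcase z hz1
  have hv2 := hcase v hv1
  have hw2 : w = p ∨ w = s p := by
    by_contra h
    exact hw1 (by simpa using h)
  have hu2 : u = p ∨ u = s p := by simpa using hu1
  have np1 := hb.not_adj hbq
  have np2 := hb.not_adj hbq.symm
  have hbs : b (s q) = b (s p) := by simp [hb.color_apply hs, hbq]
  have nq1 := hb.not_adj hbs
  have nq2 := hb.not_adj hbs.symm
  have hout : D.Adj p (s q) ∨ D.Adj (s p) q := by
    rcases hu2 with rfl | rfl <;> rcases hv2 with rfl | rfl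
    · exact absurd huv np2
    · exact Or.inl huv
    · exact Or.inr huv
    · exact absurd huv nq2
  have hin : D.Adj q (s p) ∨ D.Adj (s q) p := by
    rcases hz2 with rfl | rfl <;> rcases hw2 with rfl | rfl
    · exact absurd hzw np1
    · exact Or.inl hzw
    · exact Or.inr hzw
    · exact absurd hzw nq1
  rcases hout with h1 | h1
  · rcases hin with h2 | h2
    · exact absurd h2 (hu p q hpq h1)
    · exact key p q hpq hbq h1 h2
  · rcases hin with h2 | h2
    · exact key q p (fun h => hpq h.symm) hbq.symm h2 h1
    · have := hu (s p) (s q) (by rwa [sameCycle_apply_left, sameCycle_apply_right]) (by rwa [hq])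
      rw [hp] at this
      exact absurd h2 this

theorem sameCycle_iff_of_two_cycle {s : Perm V} {x v : V} (hx : s (s x) = x) :
    s.SameCycle x v ↔ v = x ∨ v = s x := by
  constructor
  · intro h
    obtain ⟨k, -, hk⟩ := h.exists_pow_eq'
    rw [← hk]
    clear hk
    induction k with
    | zero => simp
    | succ k ih =>
      rw [pow_succ', Perm.mul_apply]
      rcases ih with h | h <;> rw [h]
      · exact Or.inr rfl
      · exact Or.inl hx
  · rintro (rfl | rfl)
    · exact SameCycle.refl _ _
    · rw [sameCycle_apply_right]

theorem IsUnmergeable.isSplit_pair {s : Perm V} (hu : D.IsUnmergeable s) {x : V}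
    (hx : s (s x) = x) : D.IsSplit s {x, s x} := by
  classical
  have : univ.filter (s.SameCycle x) = {x, s x} := by
    ext v
    simp [sameCycle_iff_of_two_cycle hx]
  rw [← this]
  convert hu.isSplit x

/-- For `a = 3` the bounds `0 < missIn < 2` and `miss = 2` leave exactly one missing out-arc at `x`.
-/
theorem IsTightTwoCycle.adj_or {s : Perm V} {x u v : V} (hb : D.IsBicoloring b 3)
    (hs : D.IsFactor s) (h : D.IsTightTwoCycle b 3 s x) (hxu : x ≠ u) (hxv : x ≠ v) (huv : u ≠ v)
    (bu : b u = b x) (bv : b v = b x) :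
    (D.Adj x (s u) ∧ ¬ D.Adj x (s v)) ∨ (D.Adj x (s v) ∧ ¬ D.Adj x (s u)) := by
  have h1 := h.miss_eq
  have h2 := h.missIn_pos
  have h3 := h.missIn_lt
  unfold miss at h1
  have h4 : D.missOut b univ x = 1 := by omega
  by_cases hu : D.Adj x (s u) <;> by_cases hv : D.Adj x (s v)
  · exfalso
    have : D.missOut b univ x = 0 := by
      unfold missOut
      classical
      rw [card_eq_zero, filter_eq_empty_iff]
      rintro w - ⟨hw, hxw⟩
      have := hb.eq_or_eq_or_eq (x := s x) (y := s u) (z := s v) (v := w)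
        (fun h => hxu (s.injective h)) (fun h => hxv (s.injective h))
        (fun h => huv (s.injective h)) (by simp [hb.color_apply hs, bu])
        (by simp [hb.color_apply hs, bv])
        (by rw [hb.color_apply hs]; cases h1 : b w <;> cases h2 : b x <;> simp_all)
      rcases this with rfl | rfl | rfl
      · exact hxw (hs x)
      · exact hxw hu
      · exact hxw hv
    omega
  · exact Or.inl ⟨hu, hv⟩
  · exact Or.inr ⟨hv, hu⟩
  · exfalso
    have := card_le_missOut (D := D) (b := b) (S := univ) (A := {s u, s v}) (v := x)
      (subset_univ _) (by
        intro w hw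
        simp only [mem_insert, mem_singleton] at hw
        rcases hw with rfl | rfl
        · exact ⟨by simp [hb.color_apply hs, bu], hu⟩
        · exact ⟨by simp [hb.color_apply hs, bv], hv⟩)
    rw [card_pair (fun h => huv (s.injective h))] at this
    omega

theorem IsTightTwoCycle.adj_or' {s : Perm V} {x u v : V} (hb : D.IsBicoloring b 3)
    (hs : D.IsFactor s) (hxx : s (s x) = x)
    (h : D.IsTightTwoCycle b 3 s x) (hxu : x ≠ u) (hxv : x ≠ v) (huv : u ≠ v)
    (bu : b u = b x) (bv : b v = b x) :
    (D.Adj (s u) x ∧ ¬ D.Adj (s v) x) ∨ (D.Adj (s v) x ∧ ¬ D.Adj (s u) x) := by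
  have h2 := h.missIn_pos
  have h3 := h.missIn_lt
  have h4 : D.missIn b univ x = 1 := by omega
  by_cases hu : D.Adj (s u) x <;> by_cases hv : D.Adj (s v) x
  · exfalso
    have : D.missIn b univ x = 0 := by
      unfold missIn
      classical
      rw [card_eq_zero, filter_eq_empty_iff]
      rintro w - ⟨hw, hxw⟩
      have := hb.eq_or_eq_or_eq (x := s x) (y := s u) (z := s v) (v := w)
        (fun h => hxu (s.injective h)) (fun h => hxv (s.injective h))
        (fun h => huv (s.injective h)) (by simp [hb.color_apply hs, bu])
        (by simp [hb.color_apply hs, bv])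
        (by rw [hb.color_apply hs]; cases h1 : b w <;> cases h2 : b x <;> simp_all)
      rcases this with rfl | rfl | rfl
      · have := hs (s x)
        rw [hxx] at this
        exact hxw this
      · exact hxw hu
      · exact hxw hv
    omega
  · exact Or.inl ⟨hu, hv⟩
  · exact Or.inr ⟨hv, hu⟩
  · exfalso
    have := card_le_missIn (D := D) (b := b) (S := univ) (A := {s u, s v}) (v := x)
      (subset_univ _) (by
        intro w hw
        simp only [mem_insert, mem_singleton] at hw
        rcases hw with rfl | rfl
        · exact ⟨by simp [hb.color_apply hs, bu], hu⟩
        · exact ⟨by simp [hb.color_apply hs, bv], hv⟩)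
    rw [card_pair (fun h => huv (s.injective h))] at this
    omega

/-- Tightness propagates cyclically: `x → s u` excludes `u → s x`, which forces `u → s v`, which in
turn forces `v → s x`. Together with the arcs back along the 2-cycles this is a 6-cycle. -/
theorem isHamiltonian_of_three_two_cycles (hb : D.IsBicoloring b 3)
    {s : Perm V} (hs : D.IsFactor s) {x u v : V} (hxu : x ≠ u) (hxv : x ≠ v) (huv : u ≠ v)
    (bu : b u = b x) (bv : b v = b x) (hx : s (s x) = x) (hu : s (s u) = u) (hv : s (s v) = v)
    (tx : D.IsTightTwoCycle b 3 s x) (tu : D.IsTightTwoCycle b 3 s u)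
    (tv : D.IsTightTwoCycle b 3 s v) (h1 : D.Adj x (s u)) : D.IsHamiltonian := by
  have n1 := (tx.adj_iff u bu hxu.symm).1 h1
  have h2 : D.Adj u (s v) := by
    rcases tu.adj_or hb hs hxu.symm huv hxv bu.symm (bv.trans bu.symm) with h | h
    · exact absurd h.1 n1
    · exact h.1
  have n2 := (tu.adj_iff v (bv.trans bu.symm) huv.symm).1 h2
  have h3 : D.Adj v (s x) := by
    rcases tv.adj_or hb hs hxv.symm huv.symm hxu bv.symm (bu.trans bv.symm) with h | h
    · exact h.1
    · exact absurd h.1 n2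
  have ex := hs (s x)
  have eu := hs (s u)
  have ev := hs (s v)
  rw [hx] at ex
  rw [hu] at eu
  rw [hv] at ev
  refine isHamiltonian_of_isChain (x := x) (t := [s u, u, s v, v, s x]) (by simp)
    (by rw [hb.card_eq_two_mul]; rfl) ?_ (by simp [h1, h2, h3, ex, eu, ev])
  intro w
  rcases Bool.eq_or_eq_not (b w) (b x) with h | h
  · rcases hb.eq_or_eq_or_eq hxu hxv huv bu bv h with rfl | rfl | rfl <;> simp
  · rcases hb.eq_or_eq_or_eq (x := s x) (y := s u) (z := s v) (v := w)
      (fun h => hxu (s.injective h)) (fun h => hxv (s.injective h))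
      (fun h => huv (s.injective h)) (by simp [hb.color_apply hs, bu])
      (by simp [hb.color_apply hs, bv]) (by rw [h, hb.color_apply hs]) with rfl | rfl | rfl <;> simp

/-- Tightness determines all arcs at the 2-cycle once it is known which of `s u`, `s v` dominates
`x`. In both cases some vertex of the 4-cycle is not joined at all to one vertex of the 2-cycle, so
it has all its other arcs. Two possible arcs stay open: either of them closes a hamiltonian cycle,
and without both the digraph is `H₃`. -/
theorem isHamiltonian_or_isIsomorphic_of_two_cycle_four_cycle (hb : D.IsBicoloring b 3)
    {s : Perm V} (hs : D.IsFactor s) {x u v : V} (hxu : x ≠ u) (hxv : x ≠ v) (huv : u ≠ v)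
    (bu : b u = b x) (bv : b v = b x) (hx : s (s x) = x) (hu : s (s u) = v) (hv : s (s v) = u)
    (t : D.IsTightTwoCycle b 3 s x) (h1 : D.Adj x (s u)) :
    D.IsHamiltonian ∨ D.IsIsomorphic digraphH3 := by
  have exu : s x ≠ s u := fun h => hxu (s.injective h)
  have exv : s x ≠ s v := fun h => hxv (s.injective h)
  have euv : s u ≠ s v := fun h => huv (s.injective h)
  have bsx := hb.color_apply hs x
  have bsu : b (s u) = !b x := by rw [hb.color_apply hs u, bu]
  have bsv : b (s v) = !b x := by rw [hb.color_apply hs v, bv]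
  have nx : ∀ c : Bool, (!c) ≠ c := by decide
  have nx' : ∀ c : Bool, c ≠ (!c) := by decide
  have n1 : ¬ D.Adj x (s v) := by
    rcases t.adj_or hb hs hxu hxv huv bu bv with h | h
    · exact h.2
    · exact absurd h1 h.2
  have n2 := (t.adj_iff u bu hxu.symm).1 h1
  have h2 : D.Adj v (s x) := not_not.1 fun h => n1 ((t.adj_iff v bv hxv.symm).2 h)
  have t1 := t.adj_iff' (s u) (by rw [bsu]; exact nx _) exu.symm
  have t2 := t.adj_iff' (s v) (by rw [bsv]; exact nx _) exv.symm
  rw [hu] at t1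
  rw [hv] at t2
  have g1 := hs u
  have g2 := hs v
  have g3 := hs (s u)
  have g4 := hs (s v)
  have g5 := hs x
  have g6 := hs (s x)
  rw [hu] at g3
  rw [hv] at g4
  rw [hx] at g6
  have hcov : ∀ w, w = x ∨ w = u ∨ w = v ∨ w = s x ∨ w = s u ∨ w = s v := by
    intro w
    rcases Bool.eq_or_eq_not (b w) (b x) with h | h
    · rcases hb.eq_or_eq_or_eq hxu hxv huv bu bv h with h | h | h <;> simp [h]
    · rcases hb.eq_or_eq_or_eq (x := s x) (y := s u) (z := s v) (v := w)
        exu exv euv (by rw [bsu, bsx]) (by rw [bsv, bsx]) (by rw [h, bsx]) with h | h | h <;>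
        simp [h]
  have hu_x : u ≠ s x := fun h => by rw [h, bsx] at bu; exact nx _ bu
  have mu : D.miss b u ≤ 2 := t.miss_le u hxu.symm hu_x
  have msv : D.miss b (s v) ≤ 2 :=
    t.miss_le (s v) (fun h => by rw [h] at bsv; exact nx' _ bsv) exv.symm
  rcases t.adj_or' hb hs hx hxu hxv huv bu bv with ⟨h3, n3⟩ | ⟨h3, n3⟩
  · have n4 : ¬ D.Adj (s x) v := fun h => t1.1 h h3
    have h4 : D.Adj (s x) u := t2.2 n3
    -- The two arcs between `s v` and `x` are both missing, which exhausts the allowance of `s v`.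
    have h5 : D.Adj u (s v) := by
      by_contra hcon
      have := card_add_card_le_miss (D := D) (b := b) (v := s v) (A := {x}) (B := {x, u})
        (by simp [n3, bsv]) (by simp [n1, hcon, bsv, bu])
      rw [card_pair hxu, card_singleton] at this
      omega
    have h6 : D.Adj (s v) v := by
      by_contra hcon
      have := card_add_card_le_miss (D := D) (b := b) (v := s v) (A := {x, v}) (B := {x})
        (by simp [n3, bsv, bv, hcon]) (by simp [n1, bsv])
      rw [card_pair hxv, card_singleton] at this
      omega
    by_cases c1 : D.Adj v (s u)
    · left
      refine isHamiltonian_of_isChain (x := x) (t := [s x, u, s v, v, s u]) (by simp)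
        (by rw [hb.card_eq_two_mul]; rfl) ?_ (by simp [g5, h4, h5, h6, c1, h3])
      intro w
      rcases hcov w with h | h | h | h | h | h <;> simp [h]
    by_cases c2 : D.Adj (s u) u
    · left
      refine isHamiltonian_of_isChain (x := s x) (t := [x, s u, u, s v, v]) (by simp)
        (by rw [hb.card_eq_two_mul]; rfl) ?_ (by simp [g6, h1, c2, h5, h6, h2])
      intro w
      rcases hcov w with h | h | h | h | h | h <;> simp [h]
    right
    exact isIsomorphic_digraphH3 hb (x₁ := u) (x₂ := v) (x₃ := x) (y₁ := s x) (y₂ := s u)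
      (y₃ := s v) huv hxu.symm hxv.symm exu exv euv (by rw [bv, bu]) bu.symm (by rw [bsx, bu])
      (by rw [bsu, bu]) (by rw [bsv, bu]) g1 g3 h2 h4 h5 g4 g2 h6 g5 g6 h1 h3 c2 c1 n4 n2 n1 n3
  · have n4 : ¬ D.Adj (s x) u := fun h => t2.1 h h3
    have h4 : D.Adj (s x) v := t1.2 n3
    -- Here `u` plays that role: both arcs between `u` and `s x` are missing.
    have h5 : D.Adj (s u) u := by
      by_contra hcon
      have := card_add_card_le_miss (D := D) (b := b) (v := u) (A := {s x}) (B := {s x, s u})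
        (by simp [n2, bsx, bu]) (by simp [n4, hcon, bsx, bsu, bu])
      rw [card_pair exu, card_singleton] at this
      omega
    have h6 : D.Adj u (s v) := by
      by_contra hcon
      have := card_add_card_le_miss (D := D) (b := b) (v := u) (A := {s x, s v}) (B := {s x})
        (by simp [n2, bsx, bsv, bu, hcon]) (by simp [n4, bsx, bu])
      rw [card_pair exv, card_singleton] at this
      omega
    by_cases c1 : D.Adj (s v) v
    · left
      refine isHamiltonian_of_isChain (x := x) (t := [s u, u, s v, v, s x]) (by simp)
        (by rw [hb.card_eq_two_mul]; rfl) ?_ (by simp [h1, h5, h6, c1, h2, g6])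
      intro w
      rcases hcov w with h | h | h | h | h | h <;> simp [h]
    by_cases c2 : D.Adj v (s u)
    · left
      refine isHamiltonian_of_isChain (x := x) (t := [s x, v, s u, u, s v]) (by simp)
        (by rw [hb.card_eq_two_mul]; rfl) ?_ (by simp [g5, h4, c2, h5, h6, h3])
      intro w
      rcases hcov w with h | h | h | h | h | h <;> simp [h]
    right
    exact isIsomorphic_digraphH3 hb (x₁ := x) (x₂ := v) (x₃ := u) (y₁ := s v) (y₂ := s u)
      (y₃ := s x) hxv hxu huv.symm euv.symm exv.symm exu.symm bv bu bsv bsu bsx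
      h1 g3 g2 h3 g5 g6 h2 h4 h6 g4 g1 h5 n3 c2 c1 n1 n2 n4

theorem isHamiltonian_or_isIsomorphic_digraphH3 (hb : D.IsBicoloring b 3)
    (hP : D.PairCondition b 3) (hD : D.IsStrong)
    {s : Perm V} (hs : D.IsFactor s) (hu : D.IsUnmergeable s) :
    D.IsHamiltonian ∨ D.IsIsomorphic digraphH3 := by
  rcases hs.isHamiltonian_or_exists (by norm_num) hb with h | ⟨p, q, hpq, hbq⟩
  · exact Or.inl h
  have hne : p ≠ q := by rintro rfl; exact hpq (SameCycle.refl _ _)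
  have hcol : ∀ v, b (s (s v)) = b v := fun v => by simp [hb.color_apply hs]
  have tight : ∀ x, s (s x) = x → D.IsTightTwoCycle b 3 s x := fun x hx =>
    (hu.isSplit_pair hx).isTightTwoCycle le_rfl hb hP hD hs hx
  -- Two different cycles without a 2-cycle would need at least four vertices of one colour.
  have hx : ∃ x, s (s x) = x := by
    by_contra hcon
    push Not at hcon
    have h1 : p ≠ s (s p) := (hcon p).symm
    have h2 : q ≠ s (s p) := fun h => hpq (h ▸ sameCycle_apply_apply p)
    have hq1 : s (s q) ≠ p := fun h => hpq (h ▸ (sameCycle_apply_apply q).symm)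
    rcases hb.eq_or_eq_or_eq (v := s (s q)) hne h1 h2 hbq (hcol p) (by rw [hcol, hbq])
      with h | h | h
    · exact hq1 h
    · exact hcon q h
    · exact hne (s.injective (s.injective h)).symm
  obtain ⟨x, hx⟩ := hx
  obtain ⟨u, v, huv, hset⟩ := card_eq_two.1 (show ((univ.filter (b · = b x)).erase x).card = 2 by
    rw [card_erase_of_mem (by simp), hb.card_eq])
  have hmem : ∀ w, (w = u ∨ w = v) → x ≠ w ∧ b w = b x := by
    intro w hw
    have : w ∈ (univ.filter (b · = b x)).erase x := by rw [hset]; simpa using hw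
    simp only [mem_erase, mem_filter, mem_univ, true_and] at this
    exact ⟨this.1.symm, this.2⟩
  obtain ⟨hxu, bu⟩ := hmem u (Or.inl rfl)
  obtain ⟨hxv, bv⟩ := hmem v (Or.inr rfl)
  have tx := tight x hx
  have hss : ∀ w, w ≠ x → s (s w) ≠ x := by
    intro w hw h
    rw [← hx] at h
    exact hw (s.injective (s.injective h))
  by_cases hu' : s (s u) = u
  · have hv' : s (s v) = v := by
      rcases hb.eq_or_eq_or_eq (v := s (s v)) hxu hxv huv bu bv (by rw [hcol, bv]) with h | h | h
      · exact absurd h (hss v hxv.symm)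
      · rw [← hu'] at h
        exact absurd (s.injective (s.injective h)).symm huv
      · exact h
    left
    rcases tx.adj_or hb hs hxu hxv huv bu bv with h | h
    · exact isHamiltonian_of_three_two_cycles hb hs hxu hxv huv bu bv hx hu' hv' tx
        (tight u hu') (tight v hv') h.1
    · exact isHamiltonian_of_three_two_cycles hb hs hxv hxu huv.symm bv bu hx hv' hu' tx
        (tight v hv') (tight u hu') h.1
  · have hu2 : s (s u) = v := by
      rcases hb.eq_or_eq_or_eq (v := s (s u)) hxu hxv huv bu bv (by rw [hcol, bu]) with h | h | h
      · exact absurd h (hss u hxu.symm)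
      · exact absurd h hu'
      · exact h
    have hv2 : s (s v) = u := by
      rcases hb.eq_or_eq_or_eq (v := s (s v)) hxu hxv huv bu bv (by rw [hcol, bv]) with h | h | h
      · exact absurd h (hss v hxv.symm)
      · exact h
      · exact absurd (s.injective (s.injective (h.trans hu2.symm))).symm huv
    rcases tx.adj_or hb hs hxu hxv huv bu bv with h | h
    · exact isHamiltonian_or_isIsomorphic_of_two_cycle_four_cycle hb hs hxu hxv huv bu bv hx
        hu2 hv2 tx h.1
    · exact isHamiltonian_or_isIsomorphic_of_two_cycle_four_cycle hb hs hxv hxu huv.symm bv bu hx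
        hv2 hu2 tx h.1

end Small

/-! ### Cutting one cycle into two and merging two cycles into one. -/

section Perm
variable {V : Type*} [Fintype V] [DecidableEq V]

/-- Exchanging the successors of `p` and `q` on a single cycle produces no cycle avoiding both. -/
theorem sameCycle_or_sameCycle_mul_swap {t : Perm V} {p q : V} (h : ∀ v, t.SameCycle p v) (v : V) :
    (t * swap p q).SameCycle p v ∨ (t * swap p q).SameCycle q v := by
  obtain ⟨k, -, hk⟩ := (h v).exists_pow_eq'
  rw [← hk]
  clear hk
  induction k with
  | zero => exact Or.inl (SameCycle.refl _ _)
  | succ k ih =>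
    rw [pow_succ', Perm.mul_apply]
    set z := (t ^ k) p
    by_cases hp : z = p
    · right
      rw [hp, ← sameCycle_apply_left]
      simpa using SameCycle.refl (t * swap p q) (t p)
    by_cases hq : z = q
    · left
      rw [hq, ← sameCycle_apply_left]
      simpa using SameCycle.refl (t * swap p q) (t q)
    have : (t * swap p q) z = t z := by rw [Perm.mul_apply, swap_apply_of_ne_of_ne hp hq]
    rwa [← this, sameCycle_apply_right, sameCycle_apply_right]

theorem sameCycle_mul_swap_of_two_cycles {t : Perm V} {p q : V}
    (h : ∀ v, t.SameCycle p v ∨ t.SameCycle q v) {p' q' : V} (hpq : ¬ t.SameCycle p' q') (u v : V) :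
    (t * swap p' q').SameCycle u v := by
  have h1 : ∀ v, t.SameCycle p' v ∨ t.SameCycle q' v := by
    intro v
    rcases h p' with h1 | h1 <;> rcases h q' with h2 | h2 <;> rcases h v with h3 | h3
    · exact absurd (h1.symm.trans h2) hpq
    · exact absurd (h1.symm.trans h2) hpq
    · exact Or.inl (h1.symm.trans h3)
    · exact Or.inr (h2.symm.trans h3)
    · exact Or.inr (h2.symm.trans h3)
    · exact Or.inl (h1.symm.trans h3)
    · exact absurd (h1.symm.trans h2) hpq
    · exact absurd (h1.symm.trans h2) hpq
  have h2 : ∀ v, (t * swap p' q').SameCycle p' v := by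
    intro v
    rcases h1 v with h | h
    · exact SameCycle.mul_swap hpq h
    · exact (sameCycle_mul_swap hpq).trans (SameCycle.mul_swap hpq h)
  exact (h2 u).symm.trans (h2 v)

end Perm

/-! ### For `a ≥ 4`, a 2-cycle in the factor leads to a hamiltonian cycle. -/

section NoTwoCycle
variable {V : Type*} [Fintype V] [DecidableEq V] {D : Digraph V} {b : V → Bool} {a : ℕ}

theorem IsSplit.sum_apply_eq {s : Perm V} {C : Finset V} (h : D.IsSplit s C) (f : V → ℕ) :
    ∑ v ∈ C, f (s v) = ∑ v ∈ C, f v := by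
  refine sum_bij (fun v _ => s v) (fun v hv => (h.apply_mem_iff v).2 hv)
    (fun _ _ _ _ h => s.injective h) (fun v hv => ⟨s.symm v, ?_, by simp⟩) (fun _ _ => rfl)
  rw [← h.apply_mem_iff]; simpa using hv

/-- Sum the split identity over `C`: the vertices of `C` lack on average at least as many arcs to
the outside as there are outside vertices of one colour. -/
theorem IsSplit.card_le_two {s : Perm V} {C : Finset V} (h : D.IsSplit s C) (hs : D.IsFactor s)
    (hb : D.IsBicoloring b a) (hC : C.Nonempty) (hm : ∀ v ∈ C, D.miss b v ≤ 2) (i : Bool) :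
    (Cᶜ.filter (b · = i)).card ≤ 2 := by
  have h1 : ∑ v ∈ C, (D.missOut b Cᶜ v + D.missIn b Cᶜ v) ≤ ∑ v ∈ C, 2 := by
    refine sum_le_sum fun v hv => ?_
    have h1 := hm v hv
    have h2 := missIn_add_compl (D := D) (b := b) C v
    have h3 := missOut_add_compl (D := D) (b := b) C v
    unfold miss at h1
    omega
  have h2 : ∑ v ∈ C, (Cᶜ.filter (b · = i)).card ≤
      ∑ v ∈ C, (D.missOut b Cᶜ v + D.missIn b Cᶜ (s v)) := by
    refine sum_le_sum fun v hv => ?_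
    rw [h.missOut_add_missIn hs hb hv, h.compl.card_filter hs hb i (b v)]
    exact Nat.le_add_right _ _
  rw [sum_add_distrib, h.sum_apply_eq, ← sum_add_distrib] at h2
  have h3 := h2.trans h1
  simp only [sum_const, smul_eq_mul] at h3
  exact Nat.le_of_mul_le_mul_left h3 (card_pos.2 hC)

/-- Of the vertices outside the 2-cycle that are coloured like `s x`, some dominate `x` and some do
not. Going round the other cycle two steps at a time, the property must fail somewhere after it
holds. -/
theorem IsTightTwoCycle.exists_adj_not_adj (hb : D.IsBicoloring b a) {s : Perm V}
    (hs : D.IsFactor s) {x : V} (hxx : s (s x) = x) (t : D.IsTightTwoCycle b a s x)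
    (hcyc : ∀ u v, u ≠ x → u ≠ s x → v ≠ x → v ≠ s x → s.SameCycle u v) :
    ∃ w, b w ≠ b x ∧ w ≠ s x ∧ D.Adj w x ∧ ¬ D.Adj (s (s w)) x := by
  classical
  by_contra! hcon
  have hsx : D.Adj (s x) x := by simpa [hxx] using hs (s x)
  obtain ⟨w₀, hw₀⟩ := card_pos.1 t.missIn_pos
  simp only [mem_filter, mem_univ, true_and] at hw₀
  obtain ⟨w₁, h1, h2, h3⟩ : ∃ w, b w ≠ b x ∧ w ≠ s x ∧ D.Adj w x := by
    by_contra! h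
    have h1 := card_le_missIn (D := D) (b := b) (S := univ) (v := x)
      (A := (univ.filter fun w => b w ≠ b x).erase (s x)) (subset_univ _) (by
        intro w hw
        simp only [mem_erase, mem_filter, mem_univ, true_and] at hw
        exact ⟨hw.2, h w hw.2 hw.1⟩)
    rw [card_erase_of_mem (by simp [hb.color_apply hs]), hb.card_ne] at h1
    exact absurd t.missIn_lt (by omega)
  have hne : ∀ w, b w ≠ b x → w ≠ x := fun w h h' => h (by rw [h'])
  obtain ⟨k, -, hk⟩ := (hcyc w₁ w₀ (hne _ h1) h2 (hne _ hw₀.1)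
    (fun h => hw₀.2 (h ▸ hsx))).exists_pow_eq'
  have key : ∀ k : ℕ, ∃ w, (b w ≠ b x ∧ w ≠ s x ∧ D.Adj w x) ∧
      ((s ^ k) w₁ = w ∨ (s ^ k) w₁ = s w) := by
    intro k
    induction k with
    | zero => exact ⟨w₁, ⟨h1, h2, h3⟩, Or.inl rfl⟩
    | succ k ih =>
      obtain ⟨w, ⟨h1, h2, h3⟩, h⟩ := ih
      rw [pow_succ', Perm.mul_apply]
      rcases h with h | h
      · exact ⟨w, ⟨h1, h2, h3⟩, Or.inr (by rw [h])⟩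
      · refine ⟨s (s w), ⟨by simpa [hb.color_apply hs] using h1, ?_, hcon w h1 h2 h3⟩,
          Or.inl (by rw [h])⟩
        intro h'
        have h' := s.injective h'
        rw [← hxx] at h'
        exact h2 (s.injective h')
  obtain ⟨w, ⟨h1, h2, h3⟩, h⟩ := key k
  rw [hk] at h
  rcases h with rfl | rfl
  · exact hw₀.2 h3
  · refine hw₀.1 ?_
    rw [hb.color_apply hs]
    cases h4 : b w <;> cases h5 : b x <;> simp_all

-- The 2-cycle lacks too many arcs for a second 2-cycle to be tight, and the remaining vertices form
-- a single cycle. There, choose `w → x` such that `w₂ = s (s w)` does not dominate `x`; tightness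
-- gives `y → s w₂`. The detour `w → x → y → s w₂` absorbs the 2-cycle and leaves out only `u = s w`
-- and `w₂`, which must be put back.
set_option maxHeartbeats 400000 in
theorem isHamiltonian_of_two_cycle (ha : 4 ≤ a) (hb : D.IsBicoloring b a)
    (hP : D.PairCondition b a) (hD : D.IsStrong) {s : Perm V} (hs : D.IsFactor s)
    (hu : D.IsUnmergeable s) {x : V} (hxx : s (s x) = x) : D.IsHamiltonian := by
  classical
  have hV : 2 ≤ Fintype.card V := by rw [hb.card_eq_two_mul]; omega
  have tight : ∀ x, s (s x) = x → D.IsTightTwoCycle b a s x := fun x hx =>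
    (hu.isSplit_pair hx).isTightTwoCycle (by omega) hb hP hD hs hx
  have t := tight x hxx
  have hmx := t.miss_eq
  have hcol : ∀ v, b (s (s v)) = b v := fun v => by simp [hb.color_apply hs]
  have hno : ∀ u, u ≠ x → u ≠ s x → s (s u) ≠ u := by
    intro u h1 h2 h3
    have := (tight u h3).miss_le x h1.symm (fun h => h2 (by rw [h, h3]))
    omega
  have hsc := fun v => sameCycle_iff_of_two_cycle (v := v) hxx
  -- Vertices off the 2-cycle lack at most 2 arcs, so the complement of a cycle `C` of such vertices
  -- has at most 2 vertices per colour. A further cycle contributes `v` and `s (s v)`, and the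
  -- 2-cycle a third.
  have hcyc : ∀ u v, u ≠ x → u ≠ s x → v ≠ x → v ≠ s x → s.SameCycle u v := by
    intro u v hu1 hu2 hv1 hv2
    by_contra huv
    set C := univ.filter (s.SameCycle u) with hC
    have hsplit : D.IsSplit s C := by
      rw [hC]; convert hu.isSplit u
    have hxC : ¬ s.SameCycle u x := fun h => by
      rcases (hsc u).1 h.symm with h | h
      · exact hu1 h
      · exact hu2 h
    have hm : ∀ w ∈ C, D.miss b w ≤ 2 := by
      intro w hw
      simp only [hC, mem_filter, mem_univ, true_and] at hw
      refine t.miss_le w ?_ ?_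
      · rintro rfl; exact hxC hw
      · rintro rfl; exact hxC (sameCycle_apply_right.1 hw)
    have h2 := hsplit.card_le_two hs hb ⟨u, by simp [hC, SameCycle.refl]⟩ hm (b v)
    obtain ⟨z, hz, hzx⟩ : ∃ z, b z = b v ∧ (z = x ∨ z = s x) := by
      rcases Bool.eq_or_eq_not (b x) (b v) with h | h
      · exact ⟨x, h, Or.inl rfl⟩
      · exact ⟨s x, by rw [hb.color_apply hs, h, Bool.not_not], Or.inr rfl⟩
    have hzC : ¬ s.SameCycle u z := by
      rcases hzx with rfl | rfl
      · exact hxC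
      · rwa [sameCycle_apply_right]
    have h3 : ({z, v, s (s v)} : Finset V) ⊆ Cᶜ.filter (b · = b v) := by
      intro w hw
      simp only [mem_insert, mem_singleton] at hw
      simp only [hC, mem_filter, mem_compl, mem_univ, true_and]
      rcases hw with rfl | rfl | rfl
      · exact ⟨hzC, hz⟩
      · exact ⟨huv, rfl⟩
      · rw [sameCycle_apply_right, sameCycle_apply_right]
        exact ⟨huv, hcol v⟩
    have hzv : z ≠ v := by
      rcases hzx with rfl | rfl
      · exact hv1.symm
      · exact hv2.symm
    have hzs : z ≠ s (s v) := by
      intro h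
      have h6 : s.SameCycle x v := by
        have h4 := sameCycle_apply_apply (s := s) v
        rw [← h] at h4
        have h5 := ((hsc z).2 hzx)
        exact h5.trans h4.symm
      rcases (hsc v).1 h6 with h | h
      · exact hv1 h
      · exact hv2 h
    have h4 := card_le_card h3
    rw [card_eq_three.2 ⟨z, v, s (s v), hzv, hzs, (hno v hv1 hv2).symm, rfl⟩] at h4
    omega
  obtain ⟨w, bw, hwy, hwx, hw2⟩ := t.exists_adj_not_adj hb hs hxx hcyc
  set y := s x with hy
  set u := s w with hu'
  set w₂ := s u with hw₂
  have bu : b u = b x := by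
    rw [hu', hb.color_apply hs]
    cases h4 : b w <;> cases h5 : b x <;> simp_all
  have b_y : b y = !b x := hb.color_apply hs x
  have bw' : b w = !b x := by
    cases h4 : b w <;> cases h5 : b x <;> simp_all
  have bw2 : b w₂ = !b x := by rw [hw₂, hb.color_apply hs, bu]
  have hbne : ∀ {p q}, b p = b x → b q = (!b x) → p ≠ q := by
    rintro p q h1 h2 rfl
    rw [h1] at h2
    simp at h2
  have hwx' : w ≠ x := (hbne rfl bw').symm
  have hw2w : w₂ ≠ w := hno w hwx' hwy
  have hw2y : w₂ ≠ y := by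
    intro h
    apply hwy
    apply s.injective
    apply s.injective
    rw [← hu', ← hw₂, h, hxx]
  have hw2x : w₂ ≠ x := (hbne rfl bw2).symm
  have hux : u ≠ x := by
    intro h
    apply hwy
    apply s.injective
    rw [← hu', h, hxx]
  have huy : u ≠ y := hbne bu b_y
  have nyu : ¬ D.Adj y u := fun h => (t.adj_iff' w bw hwy).1 h hwx
  have ysw : D.Adj y (s w₂) := (t.adj_iff' w₂ (by rw [bw2]; simp) hw2y).2 hw2
  -- the permutation that follows `w → x → y → s w₂` and `w₂ → u → w₂`
  set t₁ := s * swap w y with ht₁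
  set t₂ := t₁ * swap y w₂ with ht₂
  have hwy' : ¬ s.SameCycle w y := by
    intro h
    rcases (hsc w).1 (sameCycle_apply_left.1 h.symm) with h | h
    · exact hwx' h
    · exact hwy h
  have full₁ : ∀ u v, t₁.SameCycle u v := by
    refine sameCycle_mul_swap_of_two_cycles (p := w) (q := y) (fun v => ?_) hwy'
    by_cases h1 : v = x
    · right; rw [h1]; exact sameCycle_apply_left.2 (SameCycle.refl _ _)
    by_cases h2 : v = y
    · right; rw [h2]
    · left; exact hcyc w v hwx' hwy h1 h2
  have e_w : t₂ w = x := by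
    rw [ht₂, Perm.mul_apply, swap_apply_of_ne_of_ne hwy hw2w.symm, ht₁, Perm.mul_apply,
      swap_apply_left, hxx]
  have e_y : t₂ y = s w₂ := by
    rw [ht₂, Perm.mul_apply, swap_apply_left, ht₁, Perm.mul_apply,
      swap_apply_of_ne_of_ne hw2w hw2y]
  have e_w2 : t₂ w₂ = u := by
    rw [ht₂, Perm.mul_apply, swap_apply_right, ht₁, Perm.mul_apply, swap_apply_right]
  have e_other : ∀ v, v ≠ w → v ≠ y → v ≠ w₂ → t₂ v = s v := by
    intro v h1 h2 h3
    rw [ht₂, Perm.mul_apply, swap_apply_of_ne_of_ne h2 h3, ht₁, Perm.mul_apply,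
      swap_apply_of_ne_of_ne h1 h2]
  have e_u : t₂ u = w₂ := e_other u (hbne bu bw') huy (hbne bu bw2)
  have hsc₂ : ∀ v, t₂.SameCycle w₂ v ↔ v = w₂ ∨ v = u := by
    intro v
    rw [sameCycle_iff_of_two_cycle (by rw [e_w2, e_u]), e_w2]
  have two₂ : ∀ v, t₂.SameCycle y v ∨ t₂.SameCycle w₂ v :=
    sameCycle_or_sameCycle_mul_swap fun v => full₁ y v
  by_cases hwu : D.Adj w₂ u
  -- Now `t₂` is a factor with the 2-cycle on `w₂` and `u`. Any merger of its two cycles is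
  -- hamiltonian; otherwise the new 2-cycle is tight and `x` lacks at most 2 arcs, contradicting `a
  -- - 1 ≥ 3`.
  · by_contra hH
    have hf₂ : D.IsFactor t₂ := by
      intro v
      by_cases h1 : v = w
      · rw [h1, e_w]; exact hwx
      by_cases h2 : v = y
      · rw [h2, e_y]; exact ysw
      by_cases h3 : v = w₂
      · rw [h3, e_w2]; exact hwu
      · rw [e_other v h1 h2 h3]; exact hs v
    have hu₂ : D.IsUnmergeable t₂ := by
      intro p q hpq h1 h2
      exact hH ((hf₂.mul_swap h1 h2).isHamiltonian
        (sameCycle_mul_swap_of_two_cycles two₂ hpq) hV)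
    have t2 := (hu₂.isSplit_pair (x := w₂) (by rw [e_w2, e_u])).isTightTwoCycle (by omega) hb hP hD
      hf₂ (by rw [e_w2, e_u])
    have := t2.miss_le x hw2x.symm (by rw [e_w2]; exact hux.symm)
    omega
  -- As `a ≥ 4`, there is a fourth vertex `z` of this colour. The allowance of `u` is used up by the
  -- in-arcs from `y` and `w₂`, that of `w₂` by the out-arcs to `x` and `u`. Hence `z → u` and `w₂ →
  -- s z`, and the path `u → w₂` fits between `z` and `s z`.
  · obtain ⟨z, bz, hz⟩ : ∃ z, b z = (!b x) ∧ z ∉ ({w, w₂, y} : Finset V) := by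
      by_contra! hcon
      have h1 : univ.filter (b · = !b x) ⊆ ({w, w₂, y} : Finset V) := by
        intro z hz
        exact hcon z (by simpa using hz)
      have h2 := card_le_card h1
      rw [hb.card_eq] at h2
      have := card_le_three (a := w) (b := w₂) (c := y)
      omega
    simp only [mem_insert, mem_singleton, not_or] at hz
    obtain ⟨hzw, hzw2, hzy⟩ := hz
    have bsz : b (s z) = b x := by rw [hb.color_apply hs, bz, Bool.not_not]
    have mu := t.miss_le u hux huy
    have mw2 := t.miss_le w₂ hw2x hw2y
    have hzu : D.Adj z u := by
      by_contra hcon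
      have := card_add_card_le_miss (D := D) (b := b) (v := u) (A := ∅) (B := {y, w₂, z})
        (by simp) (by simp [b_y, bu, bw2, bz, nyu, hwu, hcon])
      rw [card_eq_three.2 ⟨y, w₂, z, hw2y.symm, Ne.symm hzy, Ne.symm hzw2, rfl⟩] at this
      simp only [card_empty] at this
      omega
    have hsz : D.Adj w₂ (s z) := by
      by_contra hcon
      have := card_add_card_le_miss (D := D) (b := b) (v := w₂) (A := {x, u, s z}) (B := ∅)
        (by simp [bu, bw2, bsz, hw2, hwu, hcon]) (by simp)
      rw [card_eq_three.2 ⟨x, u, s z, hux.symm, fun h => hzy (s.injective (by rw [← h, hxx])),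
        fun h => hzw (s.injective (by rw [← h])), rfl⟩] at this
      simp only [card_empty] at this
      omega
    have hn : ¬ t₂.SameCycle w₂ z := by
      rw [hsc₂]
      rintro (h | h)
      · exact hzw2 h
      · exact hbne bu bz h.symm
    refine IsFactor.isHamiltonian (s := t₂ * swap w₂ z) ?_
      (sameCycle_mul_swap_of_two_cycles two₂ hn) hV
    intro v
    rw [Perm.mul_apply]
    by_cases h3 : v = w₂
    · rw [h3, swap_apply_left, e_other z hzw hzy hzw2]; exact hsz
    by_cases h4 : v = z
    · rw [h4, swap_apply_right, e_w2]; exact hzu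
    rw [swap_apply_of_ne_of_ne h3 h4]
    by_cases h1 : v = w
    · rw [h1, e_w]; exact hwx
    by_cases h2 : v = y
    · rw [h2, e_y]; exact ysw
    · rw [e_other v h1 h2 h3]; exact hs v

end NoTwoCycle

/-! ### Without 2-cycles no vertex lacks more than `a - 1` arcs. -/

section Poor
variable {V : Type*} [Fintype V] [DecidableEq V] {D : Digraph V} {b : V → Bool} {a : ℕ}

/-- A vertex lacking more would be in no dominating pair, but its cycle does contain a vertex of
such a pair, since some arc leaves the cycle. So there are consecutive `u` and `y = s u`, with `u`
in no pair and `y` in one. Then `u` is the only in-neighbour of `y`, so `y` has all possible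
out-arcs and every other vertex of its colour lacks at most 2 arcs. The predecessor of `u` violates
this. -/
theorem IsUnmergeable.miss_le (ha : 4 ≤ a) (hb : D.IsBicoloring b a)
    (hP : D.PairCondition b a) (hD : D.IsStrong) {s : Perm V} (hs : D.IsFactor s)
    (hu : D.IsUnmergeable s) (hno : ∀ v, s (s v) ≠ v) (hnot : ¬ ∀ u v, s.SameCycle u v) (v : V) :
    D.miss b v ≤ a - 1 := by
  by_contra hv
  have hpoor : ∀ w, ¬ D.IsDominatingPair v w := fun w h => hv (hP.le (by omega) h)
  obtain ⟨z, hz⟩ : ∃ z, ¬ s.SameCycle v z := by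
    by_contra! h
    exact hnot fun p q => (h p).symm.trans (h q)
  obtain ⟨p, hp, q, hq, hpq⟩ := hD.exists_adj_of_mem {w | s.SameCycle v w} (x := v) (y := z)
    (SameCycle.refl _ _) hz
  have hp' : D.IsDominatingPair p (s.symm q) := by
    refine ⟨?_, q, hpq, by simpa using hs (s.symm q)⟩
    rintro rfl
    apply hq
    have : s.SameCycle v (s (s.symm q)) := sameCycle_apply_right.2 hp
    simpa using this
  obtain ⟨u, hvu, hu1, hu2⟩ : ∃ u, s.SameCycle v u ∧ (∀ w, ¬ D.IsDominatingPair u w) ∧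
      ∃ w, D.IsDominatingPair (s u) w := by
    by_contra! hcon
    obtain ⟨k, -, hk⟩ := SameCycle.exists_pow_eq' (show s.SameCycle v p from hp)
    have : ∀ k : ℕ, ∀ w, ¬ D.IsDominatingPair ((s ^ k) v) w := by
      intro k
      induction k with
      | zero => simpa using hpoor
      | succ k ih =>
        rw [pow_succ', Perm.mul_apply]
        exact hcon _ (sameCycle_pow_right.2 (SameCycle.refl _ _)) ih
    exact this k _ (hk ▸ hp')
  clear hpoor hp' hpq hq hp hv
  obtain ⟨w', hw'⟩ := hu2
  have my := hP.le (by omega) hw'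
  set y := s u with hy
  have bcol : ∀ w, b (s w) = !b w := hb.color_apply hs
  have hin : a - 1 ≤ D.missIn b univ y := by
    have := card_le_missIn (D := D) (b := b) (S := univ) (v := y)
      (A := (univ.filter (b · = b u)).erase u) (subset_univ _) (by
        intro w hw
        simp only [mem_erase, mem_filter, mem_univ, true_and] at hw
        exact ⟨by rw [hw.2, hy, bcol]; simp, fun h => hu1 w ⟨hw.1.symm, y, hs u, h⟩⟩)
    rwa [card_erase_of_mem (by simp), hb.card_eq] at this
  have my' := my
  unfold miss at my'
  have hout : D.missOut b univ y = 0 := by omega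
  have hyall : ∀ w, b w = b y → D.Adj y (s w) := fun w hw =>
    adj_of_missOut_eq_zero hout (mem_univ _) (by rw [bcol, hw]; simp)
  have hhigh : ∀ w, b w = b y → w ≠ y → D.miss b w ≤ 2 := by
    intro w hw hne
    rcases hP.or (x := w) (y := y) ⟨hne, s w, hs w, hyall w hw⟩ with h | h
    · exact h
    · unfold miss at h; omega
  have hSy : ∀ w, ¬ s.SameCycle v w → ¬ s.SameCycle y w := by
    intro w hw h
    exact hw (hvu.trans (sameCycle_apply_left.1 h))
  have hnu : ∀ w, D.Adj u w → w = s u := by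
    intro w hw
    by_contra hne
    refine hu1 (s.symm w) ⟨?_, w, hw, by simpa using hs (s.symm w)⟩
    rintro rfl
    simp at hne
  have hb_u : b u = !b y := by rw [hy, bcol, Bool.not_not]
  -- If not, `w` lacks both arcs with `u`, and also `w → s y`, because `y → s w` is an arc and the
  -- cycles do not merge.
  have hwu : ∀ w, ¬ s.SameCycle v w → b w = b y → D.Adj w u := by
    intro w hw hbw
    by_contra hcon
    have hwy : w ≠ y := by
      rintro rfl
      exact hw (sameCycle_apply_right.2 hvu)
    have h1 : ¬ D.Adj w (s y) := hu y w (hSy w hw) (hyall w hbw)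
    have h2 : ¬ D.Adj u w := fun h => hwy (hnu w h)
    have := card_add_card_le_miss (D := D) (b := b) (v := w) (A := {u, s y}) (B := {u})
      (by simp [hcon, h1, hb_u, hbw, bcol]) (by simp [h2, hb_u, hbw])
    rw [card_pair (hno u).symm, card_singleton] at this
    have := hhigh w hbw hwy
    omega
  set y' := s.symm u with hy'
  have hsy' : s y' = u := by simp [hy']
  have hby' : b y' = b y := by
    have := bcol y'
    rw [hsy', hb_u] at this
    simpa using this.symm
  have hyy' : y' ≠ y := by
    intro h
    exact hno u (by rw [← hy, ← h, hsy'])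
  have hns : ∀ w, ¬ s.SameCycle v w → b w = b y → ¬ D.Adj y' (s w) := by
    intro w hw hbw
    refine hu w y' (fun h => hw ?_) (by rw [hsy']; exact hwu w hw hbw)
    have : s.SameCycle w (s y') := sameCycle_apply_right.2 h
    rw [hsy'] at this
    exact hvu.trans this.symm
  obtain ⟨w, hw, hbw⟩ : ∃ w, ¬ s.SameCycle v w ∧ b w = b y := by
    rcases Bool.eq_or_eq_not (b z) (b y) with h | h
    · exact ⟨z, hz, h⟩
    · exact ⟨s z, by rwa [sameCycle_apply_right], by rw [bcol, h, Bool.not_not]⟩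
  have hw2 : ¬ s.SameCycle v (s (s w)) := by rwa [sameCycle_apply_right, sameCycle_apply_right]
  have hbw2 : b (s (s w)) = b y := by rw [bcol, bcol, Bool.not_not, hbw]
  -- The arcs `w → u` and `s (s w) → u` block two out-arcs of `y'`, and `u` dominates only `y`:
  -- three missing arcs.
  have := card_add_card_le_miss (D := D) (b := b) (v := y') (A := {s w, s (s (s w))}) (B := {u})
    (by simp [hns w hw hbw, hns _ hw2 hbw2, hby', bcol, hbw])
    (by
      simp only [mem_singleton, forall_eq]
      exact ⟨by rw [hb_u, hby']; simp, fun h => hyy' (hnu y' h)⟩)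
  rw [card_pair (fun h => hno w (s.injective h).symm), card_singleton] at this
  have := hhigh y' hby' hyy'
  omega

end Poor

/-! ### Counting missing arcs on both sides of a split. -/

section Count
variable {V : Type*} [Fintype V] [DecidableEq V] {D : Digraph V} {b : V → Bool} {a : ℕ}

/-- The number of arcs missing inside `C`. -/
noncomputable def innerMiss (D : Digraph V) (b : V → Bool) (C : Finset V) : ℕ :=
  ∑ v ∈ C, D.missOut b C v

open Classical in
/-- The number of pairs `v ∈ C`, `u ∉ C` of the same colour with neither `v → s u` nor
`u → s v`. -/
noncomputable def crossMiss (D : Digraph V) (b : V → Bool) (s : Perm V) (C : Finset V) : ℕ :=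
  ∑ v ∈ C, (Cᶜ.filter fun u => b u = b v ∧ ¬ D.Adj v (s u) ∧ ¬ D.Adj u (s v)).card

/-- The vertices of `C` of colour `i` that lack more than two arcs. -/
noncomputable def lowSet (D : Digraph V) (b : V → Bool) (C : Finset V) (i : Bool) : Finset V :=
  C.filter fun v => b v = i ∧ 2 < D.miss b v

theorem sum_missIn_eq_innerMiss (C : Finset V) : ∑ v ∈ C, D.missIn b C v = D.innerMiss b C := by
  classical
  unfold innerMiss missIn missOut
  have := sum_card_bipartiteAbove_eq_sum_card_bipartiteBelow (s := C) (t := C)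
    (fun v w => b w ≠ b v ∧ ¬ D.Adj v w)
  unfold bipartiteAbove bipartiteBelow at this
  rw [this]
  simp only [ne_comm]

theorem card_eq_filter_add_filter (C : Finset V) :
    C.card = (C.filter (b · = true)).card + (C.filter (b · = false)).card := by
  rw [← card_filter_add_card_filter_not (s := C) (fun v => b v = true)]
  simp only [Bool.not_eq_true]

theorem IsSplit.sum_miss_eq {s : Perm V} {C : Finset V} (h : D.IsSplit s C) (hs : D.IsFactor s)
    (hb : D.IsBicoloring b a) {n : ℕ} (hn : ∀ i, (Cᶜ.filter (b · = i)).card = n) :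
    ∑ v ∈ C, D.miss b v = 2 * D.innerMiss b C + C.card * n + D.crossMiss b s C := by
  classical
  have e1 : ∑ v ∈ C, D.miss b v = ∑ v ∈ C, (D.missOut b C v + D.missIn b C v) +
      ∑ v ∈ C, (D.missOut b Cᶜ v + D.missIn b Cᶜ v) := by
    rw [← sum_add_distrib]
    refine sum_congr rfl fun v _ => ?_
    have h2 := missIn_add_compl (D := D) (b := b) C v
    have h3 := missOut_add_compl (D := D) (b := b) C v
    unfold miss
    omega
  have e2 : ∑ v ∈ C, (D.missOut b Cᶜ v + D.missIn b Cᶜ v) = C.card * n + D.crossMiss b s C := by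
    rw [sum_add_distrib, ← h.sum_apply_eq (D.missIn b Cᶜ), ← sum_add_distrib, crossMiss,
      ← smul_eq_mul, ← sum_const, ← sum_add_distrib]
    refine sum_congr rfl fun v hv => ?_
    rw [h.missOut_add_missIn hs hb hv, hn]
  rw [e1, e2, sum_add_distrib, sum_missIn_eq_innerMiss]
  unfold innerMiss
  ring

/-- Compare the exact total of `miss` over `C` with the bound 2 for ordinary vertices and `2 + (a -
3)` for those in `lowSet`. -/
theorem IsSplit.innerMiss_add_le {s : Perm V} {C : Finset V} (h : D.IsSplit s C)
    (hs : D.IsFactor s) (hb : D.IsBicoloring b a) (ha : 3 ≤ a) (hmiss : ∀ v, D.miss b v ≤ a - 1)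
    {m n : ℕ} (hm : ∀ i, (C.filter (b · = i)).card = m)
    (hn : ∀ i, (Cᶜ.filter (b · = i)).card = n) :
    2 * D.innerMiss b C + 2 * m * n + D.crossMiss b s C ≤
      4 * m + (a - 3) * ((D.lowSet b C true).card + (D.lowSet b C false).card) := by
  have hC : C.card = 2 * m := by rw [card_eq_filter_add_filter (b := b), hm, hm, two_mul]
  have e := h.sum_miss_eq hs hb hn
  have hl : (D.lowSet b C true).card + (D.lowSet b C false).card =
      ∑ v ∈ C, if 2 < D.miss b v then 1 else 0 := by
    rw [← Finset.card_filter (fun v => 2 < D.miss b v) C,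
      card_eq_filter_add_filter (b := b) (C.filter fun v => 2 < D.miss b v),
      filter_filter, filter_filter]
    unfold lowSet
    simp only [and_comm]
  have : ∑ v ∈ C, D.miss b v ≤ ∑ v ∈ C, (2 + (a - 3) * if 2 < D.miss b v then 1 else 0) := by
    refine sum_le_sum fun v _ => ?_
    have := hmiss v
    split_ifs <;> omega
  rw [sum_add_distrib, ← mul_sum, ← hl, sum_const, smul_eq_mul, e, hC] at this
  omega

/-- Two vertices of `lowSet` form no dominating pair, so their out-neighbourhoods inside `C` are
disjoint and together have at most `m` elements. -/
theorem card_lowSet_mul_le (hP : D.PairCondition b a) (hb : D.IsBicoloring b a) {C : Finset V}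
    {m : ℕ} (hm : ∀ i, (C.filter (b · = i)).card = m) (i : Bool) :
    (D.lowSet b C i).card * m ≤ ∑ v ∈ C.filter (b · = i), D.missOut b C v + m := by
  classical
  have hsub : D.lowSet b C i ⊆ C.filter (b · = i) := by
    intro v hv
    simp only [lowSet, mem_filter] at hv ⊢
    exact ⟨hv.1, hv.2.1⟩
  have h1 : ∀ v ∈ D.lowSet b C i, m = D.missOut b C v + (C.filter (D.Adj v)).card := by
    intro v hv
    rw [← hm (!i), missOut, add_comm,
      ← card_filter_add_card_filter_not (s := C.filter (b · = !i)) (D.Adj v), filter_filter,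
      filter_filter]
    have hvi : b v = i := (mem_filter.1 hv).2.1
    congr 2
    · ext w
      simp only [mem_filter]
      refine and_congr_right fun _ => ⟨fun h => h.2, fun h => ⟨?_, h⟩⟩
      rw [hb.color_right h, hvi]
    · ext w
      simp only [mem_filter]
      rw [hvi]
      cases b w <;> cases i <;> simp
  have h2 : ∑ v ∈ D.lowSet b C i, (C.filter (D.Adj v)).card ≤ m := by
    rw [← card_biUnion, ← hm (!i)]
    · refine card_le_card fun w hw => ?_
      simp only [mem_biUnion, mem_filter] at hw ⊢
      obtain ⟨v, hv, hw, hvw⟩ := hw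
      exact ⟨hw, by rw [hb.color_right hvw, (mem_filter.1 hv).2.1]⟩
    · intro u hu v hv huv
      rw [Function.onFun, Finset.disjoint_left]
      intro w hw1 hw2
      rw [mem_filter] at hw1 hw2
      have h3 := (mem_filter.1 hu).2.2
      have h4 := (mem_filter.1 hv).2.2
      rcases hP.or ⟨huv, w, hw1.2, hw2.2⟩ with h | h <;> omega
  calc (D.lowSet b C i).card * m = ∑ v ∈ D.lowSet b C i, m := by rw [sum_const, smul_eq_mul]
    _ = ∑ v ∈ D.lowSet b C i, D.missOut b C v +
        ∑ v ∈ D.lowSet b C i, (C.filter (D.Adj v)).card := by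
      rw [← sum_add_distrib]; exact sum_congr rfl h1
    _ ≤ _ := add_le_add (sum_le_sum_of_subset hsub) h2

theorem innerMiss_eq_sum_add_sum (C : Finset V) : D.innerMiss b C =
    ∑ v ∈ C.filter (b · = true), D.missOut b C v +
      ∑ v ∈ C.filter (b · = false), D.missOut b C v := by
  unfold innerMiss
  rw [← sum_filter_add_sum_filter_not C (fun v => b v = true)]
  simp only [Bool.not_eq_true]

/-- For low `v ∈ C` and `u ∉ C` of one colour, `v → s u` would make them a dominating pair at `s u`,
and `u → s v` one at `s v`. -/
theorem card_lowSet_mul_card_lowSet_le (hP : D.PairCondition b a) {s : Perm V}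
    (hs : D.IsFactor s) (C : Finset V) :
    (D.lowSet b C true).card * (D.lowSet b Cᶜ true).card +
      (D.lowSet b C false).card * (D.lowSet b Cᶜ false).card ≤ D.crossMiss b s C := by
  classical
  have key : ∀ i, (D.lowSet b C i).card * (D.lowSet b Cᶜ i).card ≤
      ∑ v ∈ C.filter (b · = i),
        (Cᶜ.filter fun u => b u = b v ∧ ¬ D.Adj v (s u) ∧ ¬ D.Adj u (s v)).card := by
    intro i
    rw [← smul_eq_mul, ← sum_const]
    refine (sum_le_sum fun v hv => ?_).trans (sum_le_sum_of_subset ?_)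
    · refine card_le_card fun u hu => ?_
      simp only [lowSet, mem_filter, mem_compl] at hu hv ⊢
      have hne : v ≠ u := by rintro rfl; exact hu.1 hv.1
      refine ⟨hu.1, by rw [hu.2.1, hv.2.1], fun h => ?_, fun h => ?_⟩
      · rcases hP.or ⟨hne, s u, h, hs u⟩ with h | h <;> omega
      · rcases hP.or ⟨hne, s v, hs v, h⟩ with h | h <;> omega
    · intro v hv
      simp only [lowSet, mem_filter] at hv ⊢
      exact ⟨hv.1, hv.2.1⟩
  refine (add_le_add (key true) (key false)).trans_eq ?_
  unfold crossMiss
  rw [← sum_filter_add_sum_filter_not C (fun v => b v = true)]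
  simp only [Bool.not_eq_true]

/-- With `l = k₁ + k₂`, eliminating `μ` gives `l (m - n + 3) ≤ 2m (4 - n)`. For `n ≥ 4` this fails
when `n < m + 3` and `l ≥ 2`, by sign; when `n ≥ m + 3`, inserting `l ≤ 2m` would give `m ≤ 1`. For
`l < 2` the first inequality alone is violated. -/
theorem le_three_of_count {m n k₁ k₂ μ E : ℕ} (hm : 2 ≤ m) (hn : 2 ≤ n) (hk₁ : k₁ ≤ m)
    (hk₂ : k₂ ≤ m) (h1 : 2 * μ + 2 * m * n + E ≤ 4 * m + (m + n - 3) * (k₁ + k₂))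
    (h2 : k₁ * m + k₂ * m ≤ μ + 2 * m) : n ≤ 3 := by
  by_contra hcon
  obtain ⟨c, rfl⟩ : ∃ c, n = c + 4 := ⟨n - 4, by omega⟩
  obtain ⟨d, rfl⟩ : ∃ d, m = d + 2 := ⟨m - 2, by omega⟩
  rw [show d + 2 + (c + 4) - 3 = d + c + 3 by omega] at h1
  rw [← add_mul] at h2
  obtain ⟨l, hl⟩ : ∃ l, l = k₁ + k₂ := ⟨_, rfl⟩
  rw [← hl] at h1 h2
  have hl' : l ≤ 2 * (d + 2) := by omega
  rcases Nat.lt_or_ge l 2 with h | h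
  · interval_cases l
    · nlinarith
    · nlinarith
  · rcases Nat.lt_or_ge c (d + 1) with h3 | h3
    · nlinarith
    · obtain ⟨e, rfl⟩ : ∃ e, c = d + 1 + e := ⟨c - (d + 1), by omega⟩
      nlinarith

theorem count_cases {m n k₁ k₂ k₁' k₂' μ₁ μ₂ μ₁' μ₂' E E' : ℕ} (hm : 2 ≤ m) (hn : 2 ≤ n)
    (hk₁ : k₁ ≤ m) (hk₂ : k₂ ≤ m) (hk₁' : k₁' ≤ n) (hk₂' : k₂' ≤ n)
    (h1 : 2 * (μ₁ + μ₂) + 2 * m * n + E ≤ 4 * m + (m + n - 3) * (k₁ + k₂))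
    (h2 : k₁ * m ≤ μ₁ + m) (h2' : k₂ * m ≤ μ₂ + m) (h3 : k₁ * k₁' + k₂ * k₂' ≤ E)
    (g1 : 2 * (μ₁' + μ₂') + 2 * n * m + E' ≤ 4 * n + (m + n - 3) * (k₁' + k₂'))
    (g2 : k₁' * n ≤ μ₁' + n) (g2' : k₂' * n ≤ μ₂' + n) (g3 : k₁' * k₁ + k₂' * k₂ ≤ E') :
    m ≤ 3 ∧ n ≤ 3 ∧ ((μ₁ + μ₂ = 0 ∧ μ₁' + μ₂' = 0 ∧ m + n ≤ 5) ∨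
      (m = 2 ∧ n = 2 ∧ μ₁' + μ₂' = 0 ∧ E = 0) ∨ (m = 2 ∧ n = 2 ∧ μ₁ + μ₂ = 0 ∧ E' = 0)) := by
  have hn3 : n ≤ 3 := le_three_of_count hm hn hk₁ hk₂ h1 (by omega)
  have hm3 : m ≤ 3 := le_three_of_count hn hm hk₁' hk₂' (by rw [add_comm n m]; exact g1) (by omega)
  refine ⟨hm3, hn3, ?_⟩
  -- Fixing `m`, `n`, `k₁`, `k₂` makes all products linear in the remaining unknowns.
  interval_cases m <;> interval_cases n <;> interval_cases k₁ <;> interval_cases k₂ <;> omega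

end Count

/-! ### Joining the two sides of the splits that survive the count. -/

section Final
variable {V : Type*} [Fintype V] [DecidableEq V] {D : Digraph V} {b : V → Bool} {a : ℕ}

theorem exists_adj_of_missOut_lt {S : Finset V} {v : V}
    (h : D.missOut b S v < (S.filter (b · = !b v)).card) :
    ∃ w ∈ S, b w = (!b v) ∧ D.Adj v w := by
  by_contra! hcon
  refine absurd h (not_lt.2 (card_le_missOut (filter_subset _ _) fun w hw => ?_))
  rw [mem_filter] at hw
  exact ⟨by rw [hw.2]; simp, hcon w hw.1 hw.2⟩

theorem exists_adj_of_missIn_lt {S : Finset V} {v : V}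
    (h : D.missIn b S v < (S.filter (b · = !b v)).card) :
    ∃ w ∈ S, b w = (!b v) ∧ D.Adj w v := by
  by_contra! hcon
  refine absurd h (not_lt.2 (card_le_missIn (filter_subset _ _) fun w hw => ?_))
  rw [mem_filter] at hw
  exact ⟨by rw [hw.2]; simp, hcon w hw.1 hw.2⟩

theorem missOut_lt_of_adj (hb : D.IsBicoloring b a) {S : Finset V} {v w : V} (hw : w ∈ S)
    (hvw : D.Adj v w) : D.missOut b S v < (S.filter (b · = !b v)).card := by
  classical
  refine card_lt_card ((Finset.ssubset_iff_of_subset ?_).2 ⟨w, ?_, ?_⟩)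
  · intro u hu
    simp only [mem_filter] at hu ⊢
    refine ⟨hu.1, ?_⟩
    have := hu.2.1
    cases h1 : b u <;> cases h2 : b v <;> simp_all
  · rw [mem_filter]; exact ⟨hw, hb.color_right hvw⟩
  · simp [hvw]

theorem missIn_lt_of_adj (hb : D.IsBicoloring b a) {S : Finset V} {v w : V} (hw : w ∈ S)
    (hvw : D.Adj w v) : D.missIn b S v < (S.filter (b · = !b v)).card := by
  classical
  refine card_lt_card ((Finset.ssubset_iff_of_subset ?_).2 ⟨w, ?_, ?_⟩)
  · intro u hu
    simp only [mem_filter] at hu ⊢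
    refine ⟨hu.1, ?_⟩
    have := hu.2.1
    cases h1 : b u <;> cases h2 : b v <;> simp_all
  · rw [mem_filter]; exact ⟨hw, hb.color_left hvw⟩
  · simp [hvw]

theorem adj_of_innerMiss_eq_zero {C : Finset V} (h : D.innerMiss b C = 0) {u v : V} (hu : u ∈ C)
    (hv : v ∈ C) (huv : b v = !b u) : D.Adj u v := by
  unfold innerMiss at h
  rw [sum_eq_zero_iff] at h
  exact adj_of_missOut_eq_zero (h u hu) hv (by rw [huv]; simp)

/-- A complete balanced bipartite digraph has a hamiltonian path between any two vertices of
different colours. -/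
theorem exists_path_of_complete (m : ℕ) : ∀ {C : Finset V},
    (∀ i, (C.filter (b · = i)).card = m + 1) →
    (∀ u ∈ C, ∀ v ∈ C, b v = (!b u) → D.Adj u v) → ∀ {x y : V}, x ∈ C → y ∈ C → b y = (!b x) →
    ∃ l : List V, List.IsChain D.Adj (x :: (l ++ [y])) ∧ (∀ v ∈ C, v ∈ x :: (l ++ [y])) ∧
      l.length = 2 * m := by
  induction m with
  | zero =>
    intro C hC hadj x y hx hy hxy
    refine ⟨[], by simpa using hadj x hx y hy hxy, ?_, rfl⟩
    intro v hv
    have key : ∀ z, z ∈ C → b v = b z → v = z := by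
      intro z hz hvz
      exact card_le_one.1 (hC (b z)).le v (by simp [hv, hvz]) z (by simp [hz])
    rcases Bool.eq_or_eq_not (b v) (b x) with h | h
    · simp [key x hx h]
    · simp [key y hy (by rw [h, hxy])]
  | succ m ih =>
    intro C hC hadj x y hx hy hxy
    have pick : ∀ z : V, ∃ w ∈ C, w ≠ z ∧ b w = b z := by
      intro z
      obtain ⟨w, hw, hne⟩ := exists_mem_ne (s := C.filter (b · = b z)) (by rw [hC]; omega) z
      rw [mem_filter] at hw
      exact ⟨w, hw.1, hne, hw.2⟩
    obtain ⟨x', hx', hxx, bx'⟩ := pick x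
    obtain ⟨y', hy', hyy, b_y'⟩ := pick y
    have hxy' : x ≠ y' := by rintro rfl; rw [hxy] at b_y'; simp at b_y'
    obtain ⟨l, hl1, hl2, hl3⟩ := ih (C := (C.erase x).erase y') (x := x') (y := y) (by
      intro i
      rcases Bool.eq_or_eq_not i (b x) with h | h
      · have : ((C.erase x).erase y').filter (b · = i) = (C.filter (b · = i)).erase x := by
          ext v
          simp only [mem_filter, mem_erase]
          constructor
          · rintro ⟨⟨_, h2, h3⟩, h4⟩; exact ⟨h2, h3, h4⟩
          · rintro ⟨h2, h3, h4⟩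
            refine ⟨⟨?_, h2, h3⟩, h4⟩
            rintro rfl
            rw [b_y', hxy, h] at h4; simp at h4
        rw [this, card_erase_of_mem (by simp [hx, h]), hC]; omega
      · have : ((C.erase x).erase y').filter (b · = i) = (C.filter (b · = i)).erase y' := by
          ext v
          simp only [mem_filter, mem_erase]
          constructor
          · rintro ⟨⟨h2, _, h3⟩, h4⟩; exact ⟨h2, h3, h4⟩
          · rintro ⟨h2, h3, h4⟩
            refine ⟨⟨h2, ?_, h3⟩, h4⟩
            rintro rfl
            rw [h] at h4; simp at h4
        rw [this, card_erase_of_mem (by simp [hy', h, b_y', hxy]), hC]; omega)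
      (fun u hu v hv => hadj u (mem_of_mem_erase (mem_of_mem_erase hu)) v
        (mem_of_mem_erase (mem_of_mem_erase hv)))
      (by
        simp only [mem_erase]
        exact ⟨by rintro rfl; rw [bx', hxy] at b_y'; simp at b_y', hxx, hx'⟩)
      (by
        simp only [mem_erase]
        exact ⟨hyy.symm, by rintro rfl; simp at hxy, hy⟩)
      (by rw [hxy, bx'])
    refine ⟨y' :: x' :: l, ?_, ?_, by simp [hl3]; ring⟩
    · simp only [List.cons_append, List.isChain_cons_cons]
      exact ⟨hadj x hx y' hy' (by rw [b_y', hxy]),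
        hadj y' hy' x' hx' (by rw [bx', b_y', hxy, Bool.not_not]), hl1⟩
    · intro v hv
      by_cases h1 : v = x
      · simp [h1]
      by_cases h2 : v = y'
      · simp [h2]
      have := hl2 v (by simp [h1, h2, hv])
      simp only [List.cons_append, List.mem_cons] at this ⊢
      tauto

theorem isHamiltonian_of_two_paths {C : Finset V} {x y p q : V} {l₁ l₂ : List V}
    (h1 : List.IsChain D.Adj (y :: (l₁ ++ [x]))) (h2 : List.IsChain D.Adj (p :: (l₂ ++ [q])))
    (c1 : ∀ v ∈ C, v ∈ y :: (l₁ ++ [x])) (c2 : ∀ v ∈ Cᶜ, v ∈ p :: (l₂ ++ [q]))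
    (hxp : D.Adj x p) (hqy : D.Adj q y)
    (hlen : Fintype.card V = l₁.length + l₂.length + 4) : D.IsHamiltonian := by
  refine isHamiltonian_of_isChain (x := y) (t := l₁ ++ [x] ++ (p :: (l₂ ++ [q]))) (by simp)
    (by simp [hlen]; ring) ?_ ?_
  · intro v
    rw [← List.cons_append, List.mem_append]
    by_cases hv : v ∈ C
    · exact Or.inl (c1 v hv)
    · exact Or.inr (c2 v (by simpa using hv))
  · have e : y :: (l₁ ++ [x] ++ (p :: (l₂ ++ [q]))) ++ [y] =
        (y :: (l₁ ++ [x])) ++ ((p :: (l₂ ++ [q])) ++ [y]) := by simp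
    rw [e, List.isChain_append, List.isChain_append]
    refine ⟨h1, ⟨h2, by simp, ?_⟩, ?_⟩
    · rw [← List.cons_append, List.getLast?_concat]
      simpa using hqy
    · rw [← List.cons_append, List.getLast?_concat]
      simpa using hxp

theorem card_eq_add_of_card_filter (hb : D.IsBicoloring b a) {C : Finset V} {m n : ℕ}
    (hm : ∀ i, (C.filter (b · = i)).card = m) (hn : ∀ i, (Cᶜ.filter (b · = i)).card = n) :
    a = m + n := by
  rw [← hb.card_eq true, ← hm true, ← hn true, ← card_union_of_disjoint, ← filter_union,
    union_compl]
  exact disjoint_compl_right.mono (filter_subset _ _) (filter_subset _ _)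

/-- An arc leaving `C` at `x` and one entering at `y` close up with hamiltonian paths of the two
sides unless `x` and `y` have the same colour. If that always happens, the vertices of `C` of the
other colour have no arcs to or from the outside and lack more than 2 arcs each; but two of them
form a dominating pair at `x`. -/
theorem isHamiltonian_of_complete (hb : D.IsBicoloring b a) (hP : D.PairCondition b a)
    (hD : D.IsStrong) {C : Finset V} {m n : ℕ}
    (hm : ∀ i, (C.filter (b · = i)).card = m + 2) (hn : ∀ i, (Cᶜ.filter (b · = i)).card = n + 2)
    (hC : D.innerMiss b C = 0) (hC' : D.innerMiss b Cᶜ = 0) : D.IsHamiltonian := by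
  by_contra hH
  have key : ∀ x ∈ C, ∀ p ∉ C, ∀ q ∉ C, ∀ y ∈ C, D.Adj x p → D.Adj q y → b y = b x := by
    intro x hx p hp q hq y hy hxp hqy
    by_contra hne
    have hyx : b x = !b y := by cases h1 : b x <;> cases h2 : b y <;> simp_all
    obtain ⟨l₁, h1, c1, e1⟩ := exists_path_of_complete (D := D) (m + 1) hm
      (fun u hu v hv huv => adj_of_innerMiss_eq_zero hC hu hv huv) hy hx hyx
    obtain ⟨l₂, h2, c2, e2⟩ := exists_path_of_complete (D := D) (n + 1) hn
      (fun u hu v hv huv => adj_of_innerMiss_eq_zero hC' hu hv huv) (x := p) (y := q)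
      (by simpa using hp) (by simpa using hq)
      (by rw [hb.color_left hqy, hb.color_right hxp, hyx, Bool.not_not])
    exact hH (isHamiltonian_of_two_paths h1 h2 c1 c2 hxp hqy (by
      rw [hb.card_eq_two_mul, card_eq_add_of_card_filter hb hm hn, e1, e2]; ring))
  have ne1 : (C.filter (b · = true)).Nonempty := card_pos.1 (by rw [hm]; omega)
  have ne2 : (Cᶜ.filter (b · = true)).Nonempty := card_pos.1 (by rw [hn]; omega)
  obtain ⟨z, hz⟩ := ne1
  obtain ⟨z', hz'⟩ := ne2
  simp only [mem_filter, mem_compl] at hz hz'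
  obtain ⟨x, hx, p, hp, hxp⟩ := hD.exists_adj_of_mem (C : Set V) (x := z) (y := z') hz.1 hz'.1
  obtain ⟨q, hq, y, hy, hqy⟩ := hD.exists_adj_of_mem ((C : Set V)ᶜ) (x := z') (y := z)
    hz'.1 (by simpa using hz.1)
  simp only [Set.mem_compl_iff, mem_coe, not_not] at hx hp hq hy
  have hyx := key x hx p hp q hq y hy hxp hqy
  have hlow : ∀ v ∈ C, b v = (!b x) → 2 < D.miss b v := by
    intro v hv hvx
    have h1 : n + 2 ≤ D.missOut b Cᶜ v := by
      by_contra hlt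
      obtain ⟨w, hw, -, hvw⟩ := exists_adj_of_missOut_lt (D := D) (b := b) (S := Cᶜ) (v := v)
        (by rw [hn]; omega)
      have := key v hv w (by simpa using hw) q hq y hy hvw hqy
      rw [hyx, hvx] at this
      simp at this
    have h2 : n + 2 ≤ D.missIn b Cᶜ v := by
      by_contra hlt
      obtain ⟨w, hw, -, hvw⟩ := exists_adj_of_missIn_lt (D := D) (b := b) (S := Cᶜ) (v := v)
        (by rw [hn]; omega)
      have := key x hx p hp w (by simpa using hw) v hv hxp hvw
      rw [hvx] at this
      simp at this
    have h3 := missIn_add_compl (D := D) (b := b) C v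
    have h4 := missOut_add_compl (D := D) (b := b) C v
    unfold miss
    omega
  obtain ⟨u, hu, v, hv, huv⟩ := one_lt_card.1 (show 1 < (C.filter (b · = !b x)).card by
    rw [hm]; omega)
  rw [mem_filter] at hu hv
  have h1 := adj_of_innerMiss_eq_zero hC hu.1 hx (by rw [hu.2, Bool.not_not])
  have h2 := adj_of_innerMiss_eq_zero hC hv.1 hx (by rw [hv.2, Bool.not_not])
  rcases hP.or ⟨huv, x, h1, h2⟩ with h | h
  · have := hlow u hu.1 hu.2; omega
  · have := hlow v hv.1 hv.2; omega

/-- `C` is a 4-cycle, and with no cross defect `v` and `s v` share exactly two missing arcs, out of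
`v` and into `s v`. A 1-1 distribution lets the complete side be inserted between `v` and `s v`. So
the distribution is always 0-2 or 2-0, and because each vertex lacks at most 3 arcs it is the same
all round `C`; then nothing enters `C` or nothing leaves it. -/
theorem isHamiltonian_of_four_cycles (hb : D.IsBicoloring b 4) (hD : D.IsStrong)
    (hmiss : ∀ v, D.miss b v ≤ 3) {s : Perm V} (hs : D.IsFactor s) (hno : ∀ v, s (s v) ≠ v)
    {C : Finset V} (h : D.IsSplit s C) (hm : ∀ i, (C.filter (b · = i)).card = 2)
    (hn : ∀ i, (Cᶜ.filter (b · = i)).card = 2) (hC' : D.innerMiss b Cᶜ = 0)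
    (hE : D.crossMiss b s C = 0) : D.IsHamiltonian := by
  by_contra hH
  have bcol : ∀ w, b (s w) = !b w := hb.color_apply hs
  have hCs : ∀ v, v ∈ C → s v ∈ C := fun v hv => (h.apply_mem_iff v).2 hv
  have hpair : ∀ v ∈ C, ∀ w ∈ C, b w = b v → w = v ∨ w = s (s v) := by
    intro v hv w hw hwv
    have h1 : ({v, s (s v)} : Finset V) = C.filter (b · = b v) := by
      refine eq_of_subset_of_card_le ?_ ?_
      · intro z hz
        simp only [mem_insert, mem_singleton] at hz
        rcases hz with rfl | rfl
        · simp [hv]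
        · simp [hCs _ (hCs _ hv), bcol]
      · rw [hm, card_pair (hno v).symm]
    have h2 : w ∈ C.filter (b · = b v) := by simp [hw, hwv]
    rw [← h1] at h2
    simpa using h2
  have hfour : ∀ v ∈ C, s (s (s (s v))) = v := by
    intro v hv
    rcases hpair v hv _ (hCs _ (hCs _ (hCs _ (hCs _ hv)))) (by simp [bcol]) with h1 | h1
    · exact h1
    · exact absurd h1 (hno _)
  have hcount : ∀ v ∈ C, D.missOut b Cᶜ v + D.missIn b Cᶜ (s v) = 2 := by
    intro v hv
    unfold crossMiss at hE
    rw [sum_eq_zero_iff] at hE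
    rw [h.missOut_add_missIn hs hb hv, hn]
    have := hE v hv
    omega
  have hor : ∀ v ∈ C, D.missOut b Cᶜ v = 0 ∨ D.missIn b Cᶜ (s v) = 0 := by
    intro v hv
    by_contra! hcon
    have h0 := hcount v hv
    obtain ⟨p, hp, bp, hvp⟩ := exists_adj_of_missOut_lt (D := D) (b := b) (S := Cᶜ) (v := v)
      (by rw [hn]; omega)
    obtain ⟨q, hq, bq, hqv⟩ := exists_adj_of_missIn_lt (D := D) (b := b) (S := Cᶜ) (v := s v)
      (by rw [hn]; omega)
    obtain ⟨l, h1, c1, e1⟩ := exists_path_of_complete (D := D) 1 hn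
      (fun u hu v hv huv => adj_of_innerMiss_eq_zero hC' hu hv huv) hp hq
      (by rw [bq, bp, bcol])
    have g := hs (s (s (s v)))
    rw [hfour v hv] at g
    refine hH (isHamiltonian_of_two_paths (C := C) (x := v) (y := s v)
      (l₁ := [s (s v), s (s (s v))]) ?_ h1 ?_ c1 hvp hqv (by rw [hb.card_eq_two_mul, e1]; rfl))
    · simp [hs (s v), hs (s (s v)), g]
    · intro w hw
      rcases Bool.eq_or_eq_not (b w) (b v) with h | h
      · rcases hpair v hv w hw h with rfl | rfl <;> simp
      · rcases hpair (s v) (hCs v hv) w hw (by rw [h, bcol]) with rfl | rfl <;> simp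
  have hsum : ∀ v, D.missOut b Cᶜ v + D.missIn b Cᶜ v ≤ 3 := by
    intro v
    have h1 := hmiss v
    have h2 := missIn_add_compl (D := D) (b := b) C v
    have h3 := missOut_add_compl (D := D) (b := b) C v
    unfold miss at h1
    omega
  have hall : ∀ v ∈ C, (∀ w ∈ C, D.missOut b Cᶜ w = D.missOut b Cᶜ v) ∧
      (∀ w ∈ C, D.missIn b Cᶜ w = 2 - D.missOut b Cᶜ v) := by
    intro v hv
    have v1 := hCs _ hv
    have v2 := hCs _ v1
    have v3 := hCs _ v2
    have a0 := hcount v hv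
    have a1 := hcount _ v1
    have a2 := hcount _ v2
    have a3 := hcount _ v3
    have b0 := hor v hv
    have b1 := hor _ v1
    have b2 := hor _ v2
    have b3 := hor _ v3
    have c0 := hsum v
    have c1 := hsum (s v)
    have c2 := hsum (s (s v))
    have c3 := hsum (s (s (s v)))
    rw [hfour v hv] at a3 b3
    have hcov : ∀ w ∈ C, w = v ∨ w = s (s v) ∨ w = s v ∨ w = s (s (s v)) := by
      intro w hw
      rcases Bool.eq_or_eq_not (b w) (b v) with h | h
      · rcases hpair v hv w hw h with h | h <;> simp [h]
      · rcases hpair (s v) (hCs v hv) w hw (by rw [h, bcol]) with h | h <;> simp [h]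
    constructor
    · intro w hw
      rcases hcov w hw with h | h | h | h <;> rw [h] <;> omega
    · intro w hw
      rcases hcov w hw with h | h | h | h <;> rw [h] <;> omega
  have ne1 : (C.filter (b · = true)).Nonempty := card_pos.1 (by rw [hm]; omega)
  have ne2 : (Cᶜ.filter (b · = true)).Nonempty := card_pos.1 (by rw [hn]; omega)
  obtain ⟨z, hz⟩ := ne1
  obtain ⟨z', hz'⟩ := ne2
  simp only [mem_filter, mem_compl] at hz hz'
  obtain ⟨x, hx, p, hp, hxp⟩ := hD.exists_adj_of_mem (C : Set V) (x := z) (y := z') hz.1 hz'.1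
  obtain ⟨q, hq, y, hy, hqy⟩ := hD.exists_adj_of_mem ((C : Set V)ᶜ) (x := z') (y := z)
    hz'.1 (by simpa using hz.1)
  simp only [Set.mem_compl_iff, mem_coe, not_not] at hx hp hq hy
  have g1 := missOut_lt_of_adj hb (S := Cᶜ) (by simpa using hp) hxp
  have g2 := missIn_lt_of_adj hb (S := Cᶜ) (by simpa using hq) hqy
  rw [hn] at g1 g2
  have g3 := (hall x hx).2 y hy
  have g4 := hcount x hx
  rcases hor x hx with h | h <;> omega

theorem isHamiltonian_of_four_le (ha : 4 ≤ a) (hb : D.IsBicoloring b a)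
    (hP : D.PairCondition b a) (hD : D.IsStrong) {s : Perm V} (hs : D.IsFactor s)
    (hu : D.IsUnmergeable s) : D.IsHamiltonian := by
  classical
  by_contra hH
  have hno : ∀ v, s (s v) ≠ v := fun v hv => hH (isHamiltonian_of_two_cycle ha hb hP hD hs hu hv)
  have hnot : ¬ ∀ u v, s.SameCycle u v := fun h =>
    hH (hs.isHamiltonian h (by rw [hb.card_eq_two_mul]; omega))
  have hmiss := hu.miss_le ha hb hP hD hs hno hnot
  push Not at hnot
  obtain ⟨p, q, hpq⟩ := hnot
  have hsplit := hu.isSplit p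
  set C := univ.filter (s.SameCycle p) with hC
  obtain ⟨m, hm⟩ : ∃ m, m = (C.filter (b · = true)).card := ⟨_, rfl⟩
  obtain ⟨n, hn⟩ : ∃ n, n = (Cᶜ.filter (b · = true)).card := ⟨_, rfl⟩
  have hm' : ∀ i, (C.filter (b · = i)).card = m := fun i => by
    rw [hm]; exact hsplit.card_filter hs hb _ _
  have hn' : ∀ i, (Cᶜ.filter (b · = i)).card = n := fun i => by
    rw [hn]; exact hsplit.compl.card_filter hs hb _ _
  have two_le : ∀ {C : Finset V}, D.IsSplit s C → ∀ v ∈ C, 2 ≤ (C.filter (b · = b v)).card := by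
    intro C hsplit v hv
    rw [← card_pair (hno v).symm]
    refine card_le_card fun w hw => ?_
    simp only [mem_insert, mem_singleton] at hw
    rw [mem_filter]
    rcases hw with rfl | rfl
    · exact ⟨hv, rfl⟩
    · exact ⟨by rwa [hsplit.apply_mem_iff, hsplit.apply_mem_iff], by simp [hb.color_apply hs]⟩
  have hm2 : 2 ≤ m := by
    rw [← hm' (b p)]
    exact two_le hsplit p (by simp [hC, SameCycle.refl])
  have hn2 : 2 ≤ n := by
    rw [← hn' (b q)]
    exact two_le hsplit.compl q (by simpa [hC] using hpq)
  have hamn := card_eq_add_of_card_filter hb hm' hn'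
  have hlow : ∀ {C : Finset V} i, (D.lowSet b C i).card ≤ (C.filter (b · = i)).card := by
    intro C i
    refine card_le_card fun v hv => ?_
    simp only [lowSet, mem_filter] at hv ⊢
    exact ⟨hv.1, hv.2.1⟩
  have h1 := hsplit.innerMiss_add_le hs hb (by omega) hmiss hm' hn'
  have g1 := hsplit.compl.innerMiss_add_le hs hb (by omega) hmiss hn' (by rwa [compl_compl])
  have h3 := card_lowSet_mul_card_lowSet_le hP hs C
  have g3 := card_lowSet_mul_card_lowSet_le hP hs Cᶜ
  rw [compl_compl] at g3
  rw [innerMiss_eq_sum_add_sum, hamn] at h1 g1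
  have hcases := count_cases hm2 hn2 ((hlow true).trans_eq (hm' true))
    ((hlow false).trans_eq (hm' false)) ((hlow true).trans_eq (hn' true))
    ((hlow false).trans_eq (hn' false)) h1 (card_lowSet_mul_le hP hb hm' true)
    (card_lowSet_mul_le hP hb hm' false) h3 g1 (card_lowSet_mul_le hP hb hn' true)
    (card_lowSet_mul_le hP hb hn' false) g3
  rw [← innerMiss_eq_sum_add_sum, ← innerMiss_eq_sum_add_sum] at hcases
  obtain ⟨-, -, ⟨hc1, hc2, -⟩ | ⟨rfl, rfl, hc1, hc2⟩ | ⟨rfl, rfl, hc1, hc2⟩⟩ := hcases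
  · obtain ⟨m, rfl⟩ := Nat.exists_eq_add_of_le' hm2
    obtain ⟨n, rfl⟩ := Nat.exists_eq_add_of_le' hn2
    exact hH (isHamiltonian_of_complete hb hP hD hm' hn' hc1 hc2)
  · subst hamn
    exact hH (isHamiltonian_of_four_cycles hb hD hmiss hs hno hsplit hm' hn' hc1 hc2)
  · subst hamn
    exact hH (isHamiltonian_of_four_cycles hb hD hmiss hs hno hsplit.compl hn'
      (by rwa [compl_compl]) (by rwa [compl_compl]) hc2)

end Final

/-! ### The exceptional digraphs are not hamiltonian; passage to colourings. -/

section Main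

theorem IsHamiltonian.mono {V : Type*} {D D' : Digraph V} (h : ∀ u v, D.Adj u v → D'.Adj u v) :
    D.IsHamiltonian → D'.IsHamiltonian := fun ⟨n, c, ⟨h1, h2, h3⟩, h4⟩ =>
  ⟨n, c, ⟨h1, h2, fun i => h _ _ (h3 i)⟩, h4⟩

/-- A hamiltonian cycle can be started at any vertex. -/
theorem IsHamiltonian.exists_cycle {V : Type*} [Fintype V] {D : Digraph V} (h : D.IsHamiltonian)
    {n : ℕ} (hn : Fintype.card V = n) (v : V) : ∃ c : ZMod n → V, c 0 = v ∧
      (∀ i j, i ≠ j → c i ≠ c j) ∧ ∀ i, D.Adj (c i) (c (i + 1)) := by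
  obtain ⟨m, c, ⟨h1, h2, h3⟩, h4⟩ := h
  have : NeZero m := ⟨by omega⟩
  obtain rfl : n = m := by
    rw [← hn, ← Fintype.card_of_bijective ⟨h2, h4⟩, ZMod.card]
  obtain ⟨k, hk⟩ := h4 v
  refine ⟨fun i => c (k + i), by simpa using hk, fun i j hij h => hij (add_left_cancel (h2 h)),
    fun i => ?_⟩
  simp only [← add_assoc]
  exact h3 _

instance decidableMemOfDecidableEq {α : Type*} [DecidableEq α] (x : α) (l : List α) :
    Decidable (x ∈ l) :=
  @List.instDecidableMemOfLawfulBEq α instBEqOfDecidableEq inferInstance x l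

instance decidableRelDigraphH1 : DecidableRel digraphH1.Adj := fun u v => by
  delta digraphH1
  dsimp only
  infer_instance

instance decidableRelDigraphH2 : DecidableRel (digraphH2 True).Adj := fun u v => by
  delta digraphH2
  dsimp only
  infer_instance

instance decidableRelDigraphH3 : DecidableRel digraphH3.Adj := fun u v => by
  delta digraphH3
  dsimp only
  infer_instance

theorem not_isHamiltonian_digraphH1 : ¬ digraphH1.IsHamiltonian := by
  intro h
  obtain ⟨c, h0, hi, hc⟩ := h.exists_cycle (n := 4) (by simp) (vx 0)
  have key : ∀ q, digraphH1.Adj (vx 0) q → ∀ r, digraphH1.Adj q r → vx 0 ≠ r →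
      ∀ t, digraphH1.Adj r t → q ≠ t → ¬ digraphH1.Adj t (vx 0) := by
    decide
  rw [← h0] at key
  exact key (c 1) (hc 0) (c 2) (hc 1) (hi 0 2 (by decide)) (c 3) (hc 2)
    (hi 1 3 (by decide)) (hc 3)

/-- A finite search over closed walks of length 6 from one fixed vertex suffices. Distinctness is
imposed only between positions of equal parity, which keeps the search small. -/
theorem not_isHamiltonian_of_six {H : Digraph (Fin 3 ⊕ Fin 3)}
    (key : ∀ q, H.Adj (vx 2) q → ∀ r, H.Adj q r → vx 2 ≠ r → ∀ t, H.Adj r t → q ≠ t →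
      ∀ u, H.Adj t u → vx 2 ≠ u → r ≠ u → ∀ v, H.Adj u v → q ≠ v → t ≠ v → ¬ H.Adj v (vx 2)) :
    ¬ H.IsHamiltonian := by
  intro h
  obtain ⟨c, h0, hi, hc⟩ := h.exists_cycle (n := 6) (by simp) (vx 2)
  rw [← h0] at key
  exact key (c 1) (hc 0) (c 2) (hc 1) (hi 0 2 (by decide)) (c 3) (hc 2)
    (hi 1 3 (by decide)) (c 4) (hc 3) (hi 0 4 (by decide)) (hi 2 4 (by decide)) (c 5) (hc 4)
    (hi 1 5 (by decide)) (hi 3 5 (by decide)) (hc 5)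

set_option maxRecDepth 10000 in
set_option synthInstance.maxHeartbeats 200000 in
set_option synthInstance.maxSize 2000 in
theorem not_isHamiltonian_digraphH3 : ¬ digraphH3.IsHamiltonian := by
  refine not_isHamiltonian_of_six ?_
  decide

set_option maxRecDepth 10000 in
set_option synthInstance.maxHeartbeats 200000 in
set_option synthInstance.maxSize 2000 in
theorem not_isHamiltonian_digraphH2_true : ¬ (digraphH2 True).IsHamiltonian := by
  refine not_isHamiltonian_of_six ?_
  decide

theorem not_isHamiltonian_digraphH2_false : ¬ (digraphH2 False).IsHamiltonian := fun h =>
  not_isHamiltonian_digraphH2_true (h.mono fun u v huv => by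
    simp only [digraphH2] at huv ⊢
    tauto)

open Classical in
theorem IsBalancedBipartite.exists_isBicoloring {V : Type*} [Fintype V] {D : Digraph V} {a : ℕ}
    (h : D.IsBalancedBipartite) (ha : Fintype.card V = 2 * a) : ∃ b, D.IsBicoloring b a := by
  obtain ⟨V₁, V₂, hdisj, hunion, hcard, h1, h2⟩ := h
  have hmem : ∀ v, v ∉ V₁ → v ∈ V₂ := fun v hv => by
    have : v ∈ V₁ ∪ V₂ := by rw [hunion]; trivial
    exact this.resolve_left hv
  have hsum : V₁.ncard + V₂.ncard = 2 * a := by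
    rw [← Set.ncard_union_eq hdisj, hunion, Set.ncard_univ, Nat.card_eq_fintype_card, ha]
  refine ⟨fun v => decide (v ∈ V₁), ⟨?_, ?_⟩⟩
  · intro u v huv he
    by_cases hu : u ∈ V₁
    · have hv : v ∈ V₁ := by simpa [hu] using he
      exact h1 u hu v hv huv
    · have hv : v ∉ V₁ := by simpa [hu] using he
      exact h2 u (hmem u hu) v (hmem v hv) huv
  · intro i
    cases i
    · have : univ.filter (fun v => decide (v ∈ V₁) = false) = V₂.toFinset := by
        ext v
        simp only [mem_filter, mem_univ, true_and, decide_eq_false_iff_not, Set.mem_toFinset]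
        exact ⟨hmem v, fun h h' => Set.disjoint_left.1 hdisj h' h⟩
      rw [this, ← Set.ncard_eq_toFinset_card']
      omega
    · have : univ.filter (fun v => decide (v ∈ V₁) = true) = V₁.toFinset := by
        ext v
        simp
      rw [this, ← Set.ncard_eq_toFinset_card']
      omega

end Main

end Digraph

theorem theorem1p7 :
    (∀ {V : Type*} [Fintype V] (D : Digraph V) (a : ℕ), 2 ≤ a → Fintype.card V = 2 * a →
      D.IsStrong → D.IsBalancedBipartite →
      (∀ x y : V, D.IsDominatingPair x y →
        (2 * a - 2 ≤ D.deg x ∧ a + 1 ≤ D.deg y) ∨ (2 * a - 2 ≤ D.deg y ∧ a + 1 ≤ D.deg x)) →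
      D.IsHamiltonian ∨ D.IsIsomorphic digraphH1 ∨
        (D.IsIsomorphic (digraphH2 False) ∨ D.IsIsomorphic (digraphH2 True)) ∨
        D.IsIsomorphic digraphH3) ∧
    ¬ digraphH1.IsHamiltonian ∧ ¬ (digraphH2 False).IsHamiltonian ∧
    ¬ (digraphH2 True).IsHamiltonian ∧ ¬ digraphH3.IsHamiltonian := by
  refine ⟨?_, Digraph.not_isHamiltonian_digraphH1, Digraph.not_isHamiltonian_digraphH2_false,
    Digraph.not_isHamiltonian_digraphH2_true, Digraph.not_isHamiltonian_digraphH3⟩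
  intro V _ D a ha hV hD hbip hdeg
  classical
  obtain ⟨b, hb⟩ := hbip.exists_isBicoloring hV
  have hP : D.PairCondition b a := by
    intro x y hxy
    have hx := hb.deg_add_miss x
    have hy := hb.deg_add_miss y
    rcases hdeg x y hxy with h | h
    · left; omega
    · right; omega
  rcases Digraph.exists_isFactor_or_isIsomorphic_digraphH2 ha hb hP hD with ⟨s, hs⟩ | ⟨p, hp⟩
  · obtain ⟨t, ht, hu⟩ := hs.exists_isUnmergeable
    rcases Nat.lt_or_ge a 4 with h4 | h4
    · obtain rfl | rfl : a = 2 ∨ a = 3 := by omega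
      · rcases Digraph.isHamiltonian_or_isIsomorphic_digraphH1 hb hD ht hu with h | h
        · exact Or.inl h
        · exact Or.inr (Or.inl h)
      · rcases Digraph.isHamiltonian_or_isIsomorphic_digraphH3 hb hP hD ht hu with h | h
        · exact Or.inl h
        · exact Or.inr (Or.inr (Or.inr h))
    · exact Or.inl (Digraph.isHamiltonian_of_four_le h4 hb hP hD ht hu)
  · right; right; left
    by_cases h : p
    · right
      rwa [eq_true h] at hp
    · left
      rwa [eq_false h] at hp
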